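/- Let $k\ge 1$ and let $Z_1,\dots,Z_k$ be point processes on $\mathbb R$ with finitely many points, $Z_i=\sum_{j\le N_i}\delta_{\xi^{(i)}_j}$, and put $\nu_i(a)=\log \mathbb E\big[\sum_{j\le N_i}e^{a\xi^{(i)}_j}\big]$. Assume that for each $i$: (A1) $\nu_i$ is finite on $(-\vartheta,\infty)$ for some $\vartheta>0$; (A2) $\mathbb P(N_i=1)<1$, $\mathbb P(Z_i(\{a\})=N_i)<1$ for every $a\in\mathbb R$, and $\mathbb P(N_i\ge 1)=1$; (A3) $\mathbb E[N_i^{1+p}]<\infty$ for some $p>0$. Let $\theta_{(i)}=\inf\{a>0:\nu_i(a)/a=\nu_i'(a)\}\in(0,\infty]$, with $\inf\emptyset=\infty$. Let $q_1(n),\dots,q_k(n)$ be non-negative integers with $\sum_i q_i(n)=n$ and $q_i(n)\to\infty$ for every $i$. For each $n$ consider the time-inhomogeneous branching random walk started from one particle at $0$, in which, for $\sum_{j<i}q_j(n)<t\le\sum_{j\le i}q_j(n)$, each particle of generation $t-1$ independently produces children displaced from it according to a copy of $Z_i$. Write $S(v)$ for the position of $v$ and $|v|$ for its generation. Let $\{E_v\}_{|v|=n}$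 be i.i.d. $\mathrm{Exponential}(1)$, independent of the walk, and for $\theta>0$ let $$R_n^*(\theta)=\max_{|v|=n}\Big(S(v)-\tfrac1\theta\log E_v\Big).$$ The processes for different $n$ live on one probability space on which there is also a homogeneous branching random walk with reproduction law $Z_1$, such that for every $n$ the first $q_1(n)$ generations of the $n$-th process are those of this homogeneous walk; no other assumption is made on their joint law. Let $0<\theta<\min_i\theta_{(i)}$. Then, for the homogeneous walk with reproduction law $Z_1$, the limit $$D^\infty_{\theta,(1)}=\lim_{m\to\infty}\sum_{|v|=m}e^{\theta S(v)-m\nu_1(\theta)}$$ exists almost surely and is almost surely positive, and its law is the unique law with mean $1$ (among all laws on $\mathbb R$ with finite first moment) that solves $$\Delta\overset{d}{=}\sum_{j\le N_1}e^{\theta\xi^{(1)}_j-\nu_1(\theta)}\Delta_j,$$ where $\Delta_1,\Delta_2,\dots$ are i.i.d. copies of $\Delta$, independent of $Z_1$. Moreover, $$R_n^*(\theta)-\sum_{i=1}^k\frac{q_i(n)\nu_i(\theta)}{\theta}-\frac1\theta\log D^\infty_{\theta,(1)}\ \xrightarrow{\,d\,}\ -\frac1\theta\log E,\qquad E\sim\mathrm{Exponential}(1).$$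 In particular the centering variable $\frac1\theta\log D^\infty_{\theta,(1)}$ depends only on $\theta$ and the first displacement process. -/

import Mathlib

open MeasureTheory ProbabilityTheory Filter Topology

namespace TIBRW

/-- A finite point configuration `∑_{j < N} δ_{ξ_j}` on `ℝ`, encoded as `(N, (ξ_j)_j)`: the number
`N` of children of a particle and their displacements. Only the coordinates `ξ_j` with `j < N` are
ever used. A point process with finitely many points is described by its law, a probability measure
on `Offspring`. -/
abbrev Offspring : Type := ℕ × (ℕ → ℝ)

/-- The integral `∑_{j < N} exp (a ξ_j)` of `x ↦ exp (a x)` against a configuration. -/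
noncomputable def expSum (a : ℝ) (x : Offspring) : ℝ :=
  ∑ j ∈ Finset.range x.1, Real.exp (a * x.2 j)

/-- The log-Laplace transform `ν(a) = log E[∑_{j < N} exp (a ξ_j)]` of a point process with
law `Z`. -/
noncomputable def nu (Z : Measure Offspring) (a : ℝ) : ℝ :=
  Real.log (∫ x, expSum a x ∂Z)

/-- The standing assumptions on a point process with law `Z`. -/
structure Admissible (Z : Measure Offspring) : Prop where
  /-- `ν` is finite on `(-ϑ, ∞)` for some `ϑ > 0`. -/
  finite_nu : ∃ ϑ : ℝ, 0 < ϑ ∧ ∀ a : ℝ, -ϑ < a → Integrable (expSum a) Z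
  /-- `P(N = 1) < 1`. -/
  number_nontrivial : Z {x | x.1 = 1} < 1
  /-- `P(Z({a}) = N) < 1` for every `a`: the points are not almost surely all at `a`. -/
  position_nontrivial : ∀ a : ℝ, Z {x | ∀ j < x.1, x.2 j = a} < 1
  /-- `P(N ≥ 1) = 1`. -/
  no_extinction : ∀ᵐ x ∂Z, 1 ≤ x.1
  /-- `N` has a finite moment of order `1 + p` for some `p > 0`. -/
  moment : ∃ p : ℝ, 0 < p ∧ Integrable (fun x : Offspring => (x.1 : ℝ) ^ (1 + p)) Z

/-- `inf {a > 0 : ν(a) / a = ν'(a)}`, equal to `⊤` when the set is empty. -/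
noncomputable def thetaCrit (Z : Measure Offspring) : EReal :=
  sInf ((fun a : ℝ => (a : EReal)) '' {a : ℝ | 0 < a ∧ nu Z a / a = deriv (nu Z) a})

/-- A choice of an offspring configuration for each possible particle. Particles are labelled by
finite words; the root is `[]` and the `j`-th child of `v` is `j :: v`, so that the generation of
`v` is `v.length`. -/
abbrev Tree : Type := List ℕ → Offspring

/-- The finite set of particles alive at generation `n`. -/
def generation (x : Tree) : ℕ → Finset (List ℕ)
  | 0 => {[]}
  | n + 1 => (generation x n).biUnion fun v => (Finset.range (x v).1).image fun j => j :: v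

/-- The position `S(v)`: the sum of the displacements of `v` and of its ancestors. -/
noncomputable def position (x : Tree) : List ℕ → ℝ
  | [] => 0
  | j :: v => position x v + (x v).2 j

/-- The right-most position `max_{|v| = n} (S(v) + (1/θ) (-log e_v))` at generation `n` after the
modification of the last generation. -/
noncomputable def rightmost (θ : ℝ) (x : Tree) (e : List ℕ → ℝ) (n : ℕ) : ℝ :=
  sSup ((fun v => position x v + 1 / θ * (-Real.log (e v))) '' (generation x n : Set (List ℕ)))

/-- The normalised sum `∑_{|v| = m} exp (θ S(v) - m ν(θ))`. -/
noncomputable def additiveMartingale (Z : Measure Offspring) (θ : ℝ) (x : Tree) (m : ℕ) : ℝ :=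
  ∑ v ∈ generation x m, Real.exp (θ * position x v - m * nu Z θ)

/-- The limit as `m → ∞` of the normalised sums. -/
noncomputable def martingaleLimit (Z : Measure Offspring) (θ : ℝ) (x : Tree) : ℝ :=
  limUnder atTop (additiveMartingale Z θ x)

/-- `ρ` is a mean-one solution of the linear recursive distributional equation
`Δ =ᵈ ∑_{j < N} exp (θ ξ_j - ν(θ)) Δ_j`, where `(N, ξ)` has law `Z`, the `Δ_j` are i.i.d. with the
law `ρ` of `Δ`, and `(N, ξ)` and `(Δ_j)_j` are independent. -/
structure IsMeanOneSolution (Z : Measure Offspring) (θ : ℝ) (ρ : Measure ℝ) : Prop where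
  prob : IsProbabilityMeasure ρ
  integrable : Integrable (fun y : ℝ => y) ρ
  mean : ∫ y, y ∂ρ = 1
  fixed : (Z.prod (Measure.infinitePi fun _ : ℕ => ρ)).map
      (fun p : Offspring × (ℕ → ℝ) =>
        ∑ j ∈ Finset.range p.1.1, Real.exp (θ * p.1.2 j - nu Z θ) * p.2 j) = ρ

/-- The random family `X` drives a time inhomogeneous branching random walk with
macroscopic time steps `q 0, …, q (k - 1)` and point processes with laws `Z 0, …, Z (k - 1)`, and
`E` is the family of modifications of the last generation. A particle of generation `t - 1` with
`q 0 + ⋯ + q (i - 1) < t ≤ q 0 + ⋯ + q i` reproduces according to `Z i`. -/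
structure IsModifiedBRW {Ω : Type*} [MeasurableSpace Ω] (P : Measure Ω) {k : ℕ}
    (Z : Fin k → Measure Offspring) (q : Fin k → ℕ)
    (X : List ℕ → Ω → Offspring) (E : List ℕ → Ω → ℝ) : Prop where
  law : ∀ (i : Fin k) (v : List ℕ), ∑ j ∈ Finset.Iio i, q j < v.length + 1 →
    v.length + 1 ≤ ∑ j ∈ Finset.Iic i, q j → HasLaw (X v) (Z i) P
  indep : iIndepFun X P
  law_exp : ∀ v, HasLaw (E v) (expMeasure 1) P
  indep_exp : iIndepFun E P
  indep_tree_exp : IndepFun (fun ω v => X v ω) (fun ω v => E v ω) P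

end TIBRW

namespace TIBRW

/-! ### Deterministic trees -/

/-! Condition on the tree. Since `S(v) - (1/θ) log E_v ≤ y` means `E_v ≥ exp (θ (S(v) - y))`,
independence of the `E_v` turns the probability that this holds for all `v` into `exp (-exp (-θ y) ∑
exp (θ S(v)))`. Hence the maximum, centred by `(1/θ) log ∑ exp (θ S(v))`, has exactly the law of
`-(1/θ) log E`, for every `n` and every nonempty generation (`measure_centredRightmost_le`,
`map_centredRightmost`). What remains is that the normalised sum of the `n`-th process converges in
probability to the limit `D` of the homogeneous walk, and that `D > 0`, so that logarithms may be
taken.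

The convergence comes from an `L¹` bound of order `s ^ m`, with `s < 1` uniform in `n`, on the
increment from generation `m` to `m + 1` (`lintegral_normSum_succ_sub_le`). Given the first `m`
generations, the increment is a sum of independent centred variables, and a truncation argument
reduces it to `p`-th moments with `p > 1`. These decay because `θ` below the critical value gives `θ
ν'(θ) < ν(θ)`, hence `ν(pθ) < p ν(θ)` for `p` slightly above `1` (`Admissible.mul_deriv_nu_lt`,
`Admissible.eventually_momentBounds`). Everything after generation `q 0 n` therefore contributes at
most a constant times `s ^ q 0 n`, and up to that generation the process is the homogeneous walk.

Decomposing at the root shows that `D` solves the recursive equation. Its mean stays `1` by `L¹`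
convergence, its atom at `0` is a fixed point of the generating function of `N` and so vanishes, and
uniqueness is a contraction argument for characteristic functions (`IsMeanOneSolution.eq`). -/

theorem length_of_mem_generation {x : Tree} {n : ℕ} {v : List ℕ} (hv : v ∈ generation x n) :
    v.length = n := by
  induction n generalizing v with
  | zero => simp_all [generation]
  | succ n ih =>
    simp only [generation, Finset.mem_biUnion, Finset.mem_image, Finset.mem_range] at hv
    obtain ⟨u, hu, j, -, rfl⟩ := hv
    simp [ih hu]

theorem generation_congr {x y : Tree} {n : ℕ} (h : ∀ v : List ℕ, v.length < n → x v = y v) :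
    generation x n = generation y n := by
  induction n with
  | zero => rfl
  | succ n ih =>
    have ih' := ih fun v hv => h v (by omega)
    simp only [generation, ih']
    refine Finset.biUnion_congr rfl fun v hv => ?_
    rw [h v (by rw [length_of_mem_generation hv]; omega)]

theorem position_congr {x y : Tree} {v : List ℕ}
    (h : ∀ w : List ℕ, w.length < v.length → x w = y w) : position x v = position y v := by
  induction v with
  | nil => rfl
  | cons j v ih =>
    simp only [position]
    rw [ih fun w hw => h w (by simp; omega), h v (by simp)]

theorem sum_generation_succ {M : Type*} [AddCommMonoid M] (x : Tree) (n : ℕ) (f : List ℕ → M) :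
    ∑ w ∈ generation x (n + 1), f w
      = ∑ v ∈ generation x n, ∑ j ∈ Finset.range (x v).1, f (j :: v) := by
  rw [generation, Finset.sum_biUnion]
  · refine Finset.sum_congr rfl fun v _ => ?_
    rw [Finset.sum_image]
    intro a _ b _ hab
    exact (List.cons.inj hab).1
  · intro u _ v _ huv
    simp only [Function.onFun, Finset.disjoint_left, Finset.mem_image, not_exists, not_and]
    rintro w ⟨j, -, rfl⟩ i - h
    exact huv (List.cons.inj h).2.symm

theorem generation_nonempty {x : Tree} {n : ℕ}
    (h : ∀ v : List ℕ, v.length < n → 1 ≤ (x v).1) : (generation x n).Nonempty := by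
  induction n with
  | zero => simp [generation]
  | succ n ih =>
    obtain ⟨v, hv⟩ := ih fun v hv => h v (by omega)
    refine ⟨0 :: v, ?_⟩
    simp only [generation, Finset.mem_biUnion, Finset.mem_image, Finset.mem_range]
    exact ⟨v, hv, 0, h v (by rw [length_of_mem_generation hv]; omega), rfl⟩

/-- The tree of descendants of the `j`-th child of the root. -/
def subtree (j : ℕ) (x : Tree) : Tree := fun v => x (v ++ [j])

theorem position_append_singleton (x : Tree) (v : List ℕ) (j : ℕ) :
    position x (v ++ [j]) = (x []).2 j + position (subtree j x) v := by
  induction v with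
  | nil => simp [position]
  | cons i v ih =>
    simp only [List.cons_append, position, ih, subtree]
    ring

/-- Splits at the first generation, where `sum_generation_succ` splits at the last. The latter gives
the increments of the normalised sums, this one the recursive equation. Children are prepended to
words, so the ancestor in generation one is the last letter. -/
theorem sum_generation_succ_eq_sum_subtree {M : Type*} [AddCommMonoid M] (x : Tree) (n : ℕ)
    (f : List ℕ → M) :
    ∑ w ∈ generation x (n + 1), f w
      = ∑ j ∈ Finset.range (x []).1, ∑ v ∈ generation (subtree j x) n, f (v ++ [j]) := by
  induction n generalizing f with
  | zero => simp [generation]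
  | succ n ih =>
    rw [sum_generation_succ, ih]
    refine Finset.sum_congr rfl fun j _ => ?_
    rw [sum_generation_succ]
    rfl

/-- The sum `∑_{|v| = m} exp (θ S(v) - c 0 - ⋯ - c (m - 1))`. -/
noncomputable def normSum (θ : ℝ) (c : ℕ → ℝ) (x : Tree) (m : ℕ) : ℝ :=
  ∑ v ∈ generation x m, Real.exp (θ * position x v - ∑ t ∈ Finset.range m, c t)

/-- The sum `∑_{j < N} exp (θ ξ_j - c)`. -/
noncomputable def normOffspring (θ c : ℝ) (y : Offspring) : ℝ :=
  ∑ j ∈ Finset.range y.1, Real.exp (θ * y.2 j - c)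

theorem normSum_const (Z : Measure Offspring) (θ : ℝ) (x : Tree) (m : ℕ) :
    normSum θ (fun _ => nu Z θ) x m = additiveMartingale Z θ x m := by
  simp [normSum, additiveMartingale]

theorem normSum_congr {θ : ℝ} {c : ℕ → ℝ} {x y : Tree} {m : ℕ}
    (h : ∀ v : List ℕ, v.length < m → x v = y v) : normSum θ c x m = normSum θ c y m := by
  unfold normSum
  rw [generation_congr h]
  refine Finset.sum_congr rfl fun v hv => ?_
  rw [position_congr fun w hw => h w (by rwa [length_of_mem_generation hv] at hw)]

theorem normSum_nonneg (θ : ℝ) (c : ℕ → ℝ) (x : Tree) (m : ℕ) : 0 ≤ normSum θ c x m :=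
  Finset.sum_nonneg fun _ _ => (Real.exp_pos _).le

@[simp]
theorem normSum_zero (θ : ℝ) (c : ℕ → ℝ) (x : Tree) : normSum θ c x 0 = 1 := by
  simp [normSum, generation, position]

theorem normSum_succ (θ : ℝ) (c : ℕ → ℝ) (x : Tree) (m : ℕ) :
    normSum θ c x (m + 1) = ∑ v ∈ generation x m,
      Real.exp (θ * position x v - ∑ t ∈ Finset.range m, c t) * normOffspring θ (c m) (x v) := by
  rw [normSum, sum_generation_succ]
  refine Finset.sum_congr rfl fun v _ => ?_
  rw [normOffspring, Finset.mul_sum]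
  refine Finset.sum_congr rfl fun j _ => ?_
  rw [← Real.exp_add, position, Finset.sum_range_succ]
  ring_nf

theorem additiveMartingale_succ (Z : Measure Offspring) (θ : ℝ) (x : Tree) (m : ℕ) :
    additiveMartingale Z θ x (m + 1) = ∑ j ∈ Finset.range (x []).1,
      Real.exp (θ * (x []).2 j - nu Z θ) * additiveMartingale Z θ (subtree j x) m := by
  rw [additiveMartingale, sum_generation_succ_eq_sum_subtree]
  refine Finset.sum_congr rfl fun j _ => ?_
  rw [additiveMartingale, Finset.mul_sum]
  refine Finset.sum_congr rfl fun v _ => ?_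
  rw [← Real.exp_add, position_append_singleton]
  push_cast
  ring_nf

/-! ### Measurability -/

/-- Sums and suprema here run over random index sets (a number of children, a generation) with
countably many possible values, so measurability may be checked on each value separately. -/
theorem measurable_comp_of_countable {α β γ : Type*} [MeasurableSpace α] [MeasurableSpace β]
    [Countable γ] {F : γ → α → β} (hF : ∀ c, Measurable (F c)) {g : α → γ}
    (hg : ∀ c, MeasurableSet {a | g a = c}) : Measurable fun a => F (g a) a := by
  intro s hs
  have : (fun a => F (g a) a) ⁻¹' s = ⋃ c, {a | g a = c} ∩ F c ⁻¹' s := by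
    ext a; simp
  rw [this]
  exact MeasurableSet.iUnion fun c => (hg c).inter (hF c hs)

theorem measurable_tree_apply (v : List ℕ) : Measurable fun x : Tree => x v :=
  measurable_pi_apply v

theorem measurableSet_generation_eq (n : ℕ) (s : Finset (List ℕ)) :
    MeasurableSet {x : Tree | generation x n = s} := by
  induction n generalizing s with
  | zero => simp [generation]
  | succ n ih =>
    have hmem : ∀ w : List ℕ, MeasurableSet {x : Tree | w ∈ generation x (n + 1)} := by
      intro w
      have : {x : Tree | w ∈ generation x (n + 1)} = ⋃ t : Finset (List ℕ),
          {x | generation x n = t} ∩ {x | ∃ v ∈ t, ∃ j < (x v).1, j :: v = w} := by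
        ext x; simp [generation]
      rw [this]
      refine MeasurableSet.iUnion fun t => (ih t).inter ?_
      have : {x : Tree | ∃ v ∈ t, ∃ j < (x v).1, j :: v = w}
          = ⋃ v ∈ t, ⋃ j : ℕ, {x : Tree | j < (x v).1 ∧ j :: v = w} := by
        ext x; simp
      rw [this]
      refine Finset.measurableSet_biUnion _ fun v _ => MeasurableSet.iUnion fun j => ?_
      refine MeasurableSet.inter ?_ (MeasurableSet.const _)
      exact measurableSet_lt measurable_const (measurable_tree_apply v).fst
    have : {x : Tree | generation x (n + 1) = s}
        = ⋂ w : List ℕ, {x | w ∈ generation x (n + 1) ↔ w ∈ s} := by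
      ext x; simp [Finset.ext_iff]
    rw [this]
    refine MeasurableSet.iInter fun w => ?_
    by_cases hw : w ∈ s
    · simpa only [hw, iff_true] using hmem w
    · simp only [hw, iff_false]
      exact (hmem w).compl

theorem measurable_generation_comp {α β : Type*} [MeasurableSpace α] [MeasurableSpace β]
    {F : Finset (List ℕ) → α → β} (hF : ∀ s, Measurable (F s)) {X : α → Tree} (hX : Measurable X)
    (n : ℕ) : Measurable fun a => F (generation (X a) n) a :=
  measurable_comp_of_countable hF fun s => hX (measurableSet_generation_eq n s)

@[fun_prop]
theorem measurable_position (v : List ℕ) : Measurable fun x : Tree => position x v := by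
  induction v with
  | nil => exact measurable_const
  | cons j v ih =>
    simp only [position]
    exact ih.add ((measurable_pi_apply j).comp (measurable_tree_apply v).snd)

@[fun_prop]
theorem measurable_normSum (θ : ℝ) (c : ℕ → ℝ) (m : ℕ) :
    Measurable fun x : Tree => normSum θ c x m := by
  refine measurable_generation_comp (X := fun x => x)
    (F := fun s x => ∑ v ∈ s, Real.exp (θ * position x v - ∑ t ∈ Finset.range m, c t))
    (fun s => ?_) measurable_id m
  fun_prop

theorem measurable_range_sum {α : Type*} [MeasurableSpace α] {N : α → ℕ} (hN : Measurable N)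
    {f : ℕ → α → ℝ} (hf : ∀ j, Measurable (f j)) :
    Measurable fun a => ∑ j ∈ Finset.range (N a), f j a :=
  measurable_comp_of_countable (F := fun n a => ∑ j ∈ Finset.range n, f j a)
    (fun n => by fun_prop) fun n => hN (measurableSet_singleton n)

@[fun_prop]
theorem measurable_expSum (a : ℝ) : Measurable (expSum a) :=
  measurable_range_sum measurable_fst fun j => by fun_prop

@[fun_prop]
theorem measurable_normOffspring (θ c : ℝ) : Measurable (normOffspring θ c) :=
  measurable_range_sum measurable_fst fun j => by fun_prop

/-! ### The law of a tree -/

/-- The law of a tree whose particles of generation `t` reproduce independently according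
to `ζ t`. -/
noncomputable def treeLaw (ζ : ℕ → Measure Offspring) : Measure Tree :=
  Measure.infinitePi fun v : List ℕ => ζ v.length

section

variable (ζ : ℕ → Measure Offspring) [∀ t, IsProbabilityMeasure (ζ t)]

instance : IsProbabilityMeasure (treeLaw ζ) := by unfold treeLaw; infer_instance

/-- The tree that agrees with `x` before generation `m` and with `y` from generation `m` on. -/
def splice (m : ℕ) (p : Tree × Tree) : Tree := fun v => if v.length < m then p.1 v else p.2 v

@[fun_prop]
theorem measurable_splice (m : ℕ) : Measurable (splice m) := by
  refine measurable_pi_lambda _ fun v => ?_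
  unfold splice
  split_ifs <;> fun_prop

/-- Coordinates before and after generation `m` are independent, so the later ones can be resampled.
With Fubini this plays the role of conditioning on the first `m` generations. -/
theorem map_splice (m : ℕ) : ((treeLaw ζ).prod (treeLaw ζ)).map (splice m) = treeLaw ζ := by
  refine Measure.eq_infinitePi _ fun s t ht => ?_
  rw [Measure.map_apply (measurable_splice m) (MeasurableSet.pi s.countable_toSet fun i _ => ht i)]
  have : splice m ⁻¹' (Set.pi s t)
      = (Set.pi (s.filter fun v => v.length < m : Finset _) t)
        ×ˢ (Set.pi (s.filter fun v => ¬ v.length < m : Finset _) t) := by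
    ext ⟨x, y⟩
    simp only [splice, Set.mem_preimage, Set.mem_pi, Set.mem_prod, SetLike.mem_coe,
      Finset.mem_filter]
    constructor
    · refine fun h => ⟨fun v hv => ?_, fun v hv => ?_⟩
      · simpa [hv.2] using h v hv.1
      · simpa [hv.2] using h v hv.1
    · rintro ⟨h1, h2⟩ v hv
      split_ifs with hm
      exacts [h1 v ⟨hv, hm⟩, h2 v ⟨hv, hm⟩]
  rw [this, Measure.prod_prod, treeLaw, Measure.infinitePi_pi _ fun i _ => ht i,
    Measure.infinitePi_pi _ fun i _ => ht i, Finset.prod_filter_mul_prod_filter_not]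

theorem generation_splice (m : ℕ) (x y : Tree) : generation (splice m (x, y)) m = generation x m :=
  generation_congr fun v hv => by simp [splice, hv]

theorem position_splice {m : ℕ} (x y : Tree) {v : List ℕ} (hv : v.length = m) :
    position (splice m (x, y)) v = position x v :=
  position_congr fun w hw => by simp [splice, hv ▸ hw]

theorem splice_apply_of_length {m : ℕ} (x y : Tree) {v : List ℕ} (hv : v.length = m) :
    splice m (x, y) v = y v := by
  simp [splice, hv]

end

/-! ### A weak von Bahr–Esseen inequality -/

theorem sq_le_abs_rpow {u p : ℝ} (hu : |u| ≤ 1) (hp0 : 0 < p) (hp : p ≤ 2) : u ^ 2 ≤ |u| ^ p := by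
  rw [← sq_abs, ← Real.rpow_natCast]
  rcases (abs_nonneg u).eq_or_lt with h | h
  · rw [← h, Real.zero_rpow (by norm_num), Real.zero_rpow hp0.ne']
  · exact Real.rpow_le_rpow_of_exponent_ge h hu (by simpa using hp)

/-- The expected absolute value of a sum of independent centred random variables is controlled by
the sum of their absolute moments of order `p ∈ [1, 2]`. -/
theorem integral_abs_sum_le_of_iIndepFun {Ω ι : Type*} [MeasurableSpace Ω] {μ : Measure Ω}
    [IsProbabilityMeasure μ] {Y : ι → Ω → ℝ} (hY : ∀ i, Measurable (Y i)) (hind : iIndepFun Y μ)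
    {p : ℝ} (hp1 : 1 ≤ p) (hp2 : p ≤ 2) (s : Finset ι) (hint : ∀ i ∈ s, Integrable (Y i) μ)
    (hmean : ∀ i ∈ s, ∫ ω, Y i ω ∂μ = 0) (hintp : ∀ i ∈ s, Integrable (fun ω => |Y i ω| ^ p) μ)
    {ε : ℝ} (hε : 0 < ε) :
    ∫ ω, |∑ i ∈ s, Y i ω| ∂μ ≤ ε / 2 + (1 / (2 * ε) + 2) * ∑ i ∈ s, ∫ ω, |Y i ω| ^ p ∂μ := by
  classical
  have hp0 : 0 < p := by linarith
  -- Truncation at level 1: small values are treated through the variance, large ones through the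
  -- first moment. As `1 ≤ p ≤ 2`, both are dominated by `|u| ^ p`.
  let T : ℝ → ℝ := fun u => if |u| ≤ 1 then u else 0
  have hT : Measurable T :=
    Measurable.ite (measurableSet_le measurable_norm measurable_const) measurable_id
      measurable_const
  have hT1 : ∀ u, |T u| ≤ 1 := by
    intro u; simp only [T]; split_ifs with h
    · exact h
    · simp
  have hT2 : ∀ u, T u ^ 2 ≤ |u| ^ p := by
    intro u; simp only [T]; split_ifs with h
    · exact sq_le_abs_rpow h hp0 hp2
    · simpa using Real.rpow_nonneg (abs_nonneg u) p
  have hT3 : ∀ u, |u - T u| ≤ |u| ^ p := by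
    intro u; simp only [T]; split_ifs with h
    · simpa using Real.rpow_nonneg (abs_nonneg u) p
    · simpa using Real.self_le_rpow_of_one_le (not_le.1 h).le hp1
  have hU : ∀ i, Measurable fun ω => T (Y i ω) := fun i => hT.comp (hY i)
  have hU2 : ∀ i, MemLp (fun ω => T (Y i ω)) 2 μ := fun i =>
    MemLp.of_bound (hU i).aestronglyMeasurable 1 (ae_of_all _ fun ω => hT1 _)
  have hUint : ∀ i, Integrable (fun ω => T (Y i ω)) μ := fun i => (hU2 i).integrable (by norm_num)
  set S : Ω → ℝ := fun ω => ∑ i ∈ s, T (Y i ω) with hS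
  have hS2 : MemLp S 2 μ := memLp_finsetSum _ fun i _ => hU2 i
  have hvar : ∫ ω, (S ω - ∫ ω', S ω' ∂μ) ^ 2 ∂μ ≤ ∑ i ∈ s, ∫ ω, |Y i ω| ^ p ∂μ := by
    rw [← variance_eq_integral hS2.aestronglyMeasurable.aemeasurable]
    have hSs : S = ∑ i ∈ s, fun ω => T (Y i ω) := by ext ω; simp [hS]
    rw [hSs, IndepFun.variance_sum (fun i _ => hU2 i)
      fun i _ j _ hij => (hind.indepFun hij).comp hT hT]
    refine Finset.sum_le_sum fun i hi => ?_
    refine (variance_le_expectation_sq (hU i).aestronglyMeasurable).trans ?_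
    exact integral_mono (hU2 i).integrable_sq (hintp i hi) fun ω => hT2 _
  have hVint : ∀ i ∈ s, Integrable (fun ω => |Y i ω - T (Y i ω)|) μ := fun i hi =>
    ((hint i hi).sub (hUint i)).abs
  have hV : ∀ i ∈ s, ∫ ω, |Y i ω - T (Y i ω)| ∂μ ≤ ∫ ω, |Y i ω| ^ p ∂μ := fun i hi =>
    integral_mono (hVint i hi) (hintp i hi) fun ω => hT3 _
  -- The `Y i` are centred, so the mean of the truncated part is minus the mean of the discarded
  -- part.
  have hES : |∫ ω, S ω ∂μ| ≤ ∑ i ∈ s, ∫ ω, |Y i ω| ^ p ∂μ := by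
    rw [hS, integral_finsetSum _ fun i _ => hUint i]
    refine (Finset.abs_sum_le_sum_abs _ _).trans (Finset.sum_le_sum fun i hi => ?_)
    have : ∫ ω, T (Y i ω) ∂μ = - ∫ ω, (Y i ω - T (Y i ω)) ∂μ := by
      rw [integral_sub (hint i hi) (hUint i), hmean i hi]; ring
    rw [this, abs_neg]
    exact (abs_integral_le_integral_abs).trans (hV i hi)
  have hsq : Integrable (fun ω => (S ω - ∫ ω', S ω' ∂μ) ^ 2) μ :=
    (hS2.sub (memLp_const _)).integrable_sq
  have hpt : ∀ ω, |∑ i ∈ s, Y i ω| ≤ (ε / 2 + 1 / (2 * ε) * (S ω - ∫ ω', S ω' ∂μ) ^ 2)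
      + (∑ i ∈ s, |Y i ω - T (Y i ω)| + |∫ ω', S ω' ∂μ|) := by
    intro ω
    have h1 : ∑ i ∈ s, Y i ω = (S ω - ∫ ω', S ω' ∂μ)
        + (∑ i ∈ s, (Y i ω - T (Y i ω)) + ∫ ω', S ω' ∂μ) := by
      rw [Finset.sum_sub_distrib]; ring
    rw [h1]
    -- From `(|z| - ε)² ≥ 0`. Keeping `ε` free avoids square roots and lets the caller balance the
    -- terms.
    have h2 : ∀ z : ℝ, |z| ≤ ε / 2 + 1 / (2 * ε) * z ^ 2 := by
      intro z
      have : 0 ≤ (|z| - ε) ^ 2 / (2 * ε) := by positivity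
      have h3 : (|z| - ε) ^ 2 / (2 * ε) = ε / 2 + 1 / (2 * ε) * z ^ 2 - |z| := by
        rw [← sq_abs z]; field_simp; ring
      linarith
    refine (abs_add_le _ _).trans (add_le_add (h2 _) ((abs_add_le _ _).trans ?_))
    gcongr
    exact Finset.abs_sum_le_sum_abs _ _
  calc ∫ ω, |∑ i ∈ s, Y i ω| ∂μ
      ≤ ∫ ω, ((ε / 2 + 1 / (2 * ε) * (S ω - ∫ ω', S ω' ∂μ) ^ 2)
          + (∑ i ∈ s, |Y i ω - T (Y i ω)| + |∫ ω', S ω' ∂μ|)) ∂μ := by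
        refine integral_mono (integrable_finsetSum _ hint).abs ?_ hpt
        exact ((integrable_const _).add (hsq.const_mul _)).add
          ((integrable_finsetSum _ hVint).add (integrable_const _))
    _ = ε / 2 + 1 / (2 * ε) * ∫ ω, (S ω - ∫ ω', S ω' ∂μ) ^ 2 ∂μ
          + (∑ i ∈ s, ∫ ω, |Y i ω - T (Y i ω)| ∂μ + |∫ ω', S ω' ∂μ|) := by
        have i1 : Integrable (fun ω => 1 / (2 * ε) * (S ω - ∫ ω', S ω' ∂μ) ^ 2) μ :=
          hsq.const_mul _
        have i2 : Integrable (fun ω => ε / 2 + 1 / (2 * ε) * (S ω - ∫ ω', S ω' ∂μ) ^ 2) μ :=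
          (integrable_const _).add i1
        have i3 : Integrable (fun ω => ∑ i ∈ s, |Y i ω - T (Y i ω)|) μ :=
          integrable_finsetSum _ hVint
        have i4 : Integrable (fun ω => ∑ i ∈ s, |Y i ω - T (Y i ω)| + |∫ ω', S ω' ∂μ|) μ :=
          i3.add (integrable_const _)
        rw [integral_add i2 i4, integral_add (integrable_const _) i1,
          integral_add i3 (integrable_const _), integral_const_mul, integral_finsetSum _ hVint]
        simp
    _ ≤ ε / 2 + 1 / (2 * ε) * ∑ i ∈ s, ∫ ω, |Y i ω| ^ p ∂μ
          + (∑ i ∈ s, ∫ ω, |Y i ω| ^ p ∂μ + ∑ i ∈ s, ∫ ω, |Y i ω| ^ p ∂μ) := by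
        exact add_le_add (add_le_add le_rfl (mul_le_mul_of_nonneg_left hvar (by positivity)))
          (add_le_add (Finset.sum_le_sum hV) hES)
    _ = _ := by ring

/-! ### Moments of the normalised sums -/

section

variable (ζ : ℕ → Measure Offspring) [∀ t, IsProbabilityMeasure (ζ t)]

theorem lintegral_treeLaw_eq (m : ℕ) {f : Tree → ENNReal} (hf : Measurable f) :
    ∫⁻ x, f x ∂treeLaw ζ = ∫⁻ x, ∫⁻ y, f (splice m (x, y)) ∂treeLaw ζ ∂treeLaw ζ := by
  conv_lhs => rw [← map_splice ζ m, lintegral_map hf (measurable_splice m)]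
  exact lintegral_prod _ (hf.comp (measurable_splice m)).aemeasurable

theorem measurePreserving_treeLaw_apply (v : List ℕ) :
    MeasurePreserving (fun x : Tree => x v) (treeLaw ζ) (ζ v.length) :=
  measurePreserving_eval_infinitePi (fun v : List ℕ => ζ v.length) v

/-- Each generation contributes an independent factor. Exponent `θ` yields mean one; exponent `p *
θ` yields the geometric decay of the sum of `p`-th powers of the weights. -/
theorem lintegral_normSum (θ : ℝ) (c : ℕ → ℝ) (m : ℕ) :
    ∫⁻ x, ENNReal.ofReal (normSum θ c x m) ∂treeLaw ζ
      = ∏ t ∈ Finset.range m, ∫⁻ y, ENNReal.ofReal (normOffspring θ (c t) y) ∂ζ t := by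
  have hW0 : ∀ c y, 0 ≤ normOffspring θ c y := fun c y =>
    Finset.sum_nonneg fun _ _ => (Real.exp_pos _).le
  induction m with
  | zero => simp
  | succ m ih =>
    rw [lintegral_treeLaw_eq ζ m (by fun_prop), Finset.prod_range_succ, ← ih,
      ← lintegral_mul_const _ (by fun_prop)]
    refine lintegral_congr fun x => ?_
    have : ∀ y, ENNReal.ofReal (normSum θ c (splice m (x, y)) (m + 1))
        = ∑ v ∈ generation x m,
          ENNReal.ofReal (Real.exp (θ * position x v - ∑ t ∈ Finset.range m, c t))
            * ENNReal.ofReal (normOffspring θ (c m) (y v)) := by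
      intro y
      rw [normSum_succ, generation_splice,
        ENNReal.ofReal_sum_of_nonneg fun v _ => mul_nonneg (Real.exp_pos _).le (hW0 _ _)]
      refine Finset.sum_congr rfl fun v hv => ?_
      rw [position_splice _ _ (length_of_mem_generation hv),
        splice_apply_of_length _ _ (length_of_mem_generation hv),
        ENNReal.ofReal_mul (Real.exp_pos _).le]
    simp_rw [this]
    have hm : ∀ v, Measurable fun y : Tree => ENNReal.ofReal (normOffspring θ (c m) (y v)) :=
      fun v => ((measurable_normOffspring θ (c m)).comp (measurable_tree_apply v)).ennreal_ofReal
    rw [lintegral_finsetSum _ fun v _ => (hm v).const_mul _, normSum,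
      ENNReal.ofReal_sum_of_nonneg fun v _ => (Real.exp_pos _).le, Finset.sum_mul]
    refine Finset.sum_congr rfl fun v hv => ?_
    rw [lintegral_const_mul _ (hm v)]
    congr 1
    have := (measurePreserving_treeLaw_apply ζ v).lintegral_comp
      (f := fun y => ENNReal.ofReal (normOffspring θ (c m) y)) (by fun_prop)
    rw [length_of_mem_generation hv] at this
    exact this

end

/-- The moment conditions on a point process under which the normalised sums converge
geometrically fast. -/
structure MomentBounds (θ p s C : ℝ) (Z : Measure Offspring) : Prop where
  integrable : Integrable (normOffspring θ (nu Z θ)) Z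
  mean : ∫ y, normOffspring θ (nu Z θ) y ∂Z = 1
  -- The square leaves room for the factor `1 / ε` with `ε = s ^ m` in the increment bound: `s ^ (2
  -- * m) / s ^ m` is still `s ^ m`.
  contraction : ∫⁻ y, ENNReal.ofReal (normOffspring (p * θ) (p * nu Z θ) y) ∂Z
    ≤ ENNReal.ofReal (s ^ 2)
  integrable_rpow : Integrable (fun y => |normOffspring θ (nu Z θ) y - 1| ^ p) Z
  moment : ∫ y, |normOffspring θ (nu Z θ) y - 1| ^ p ∂Z ≤ C

/-- Given the first `m` generations, the increment is a sum of independent centred terms, weight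
times (offspring sum minus one). Their `p`-th moments add up to at most `C` times the normalised sum
at exponent `p * θ`, whose mean is at most `ε ^ 2`. The truncation inequality then gives `ε / 2 + (1
/ (2 * ε) + 2) * C * ε ^ 2`, of order `ε = s ^ m`. -/
theorem lintegral_normSum_succ_sub_le (ζ : ℕ → Measure Offspring)
    [∀ t, IsProbabilityMeasure (ζ t)] {θ p s C : ℝ} (hp1 : 1 ≤ p) (hp2 : p ≤ 2) (hs0 : 0 < s)
    (hs1 : s ≤ 1) (hC : 0 ≤ C) {m : ℕ} (h : ∀ t ≤ m, MomentBounds θ p s C (ζ t)) :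
    ∫⁻ x, ‖normSum θ (fun t => nu (ζ t) θ) x (m + 1) - normSum θ (fun t => nu (ζ t) θ) x m‖ₑ
      ∂treeLaw ζ ≤ ENNReal.ofReal ((1 + 3 * C) * s ^ m) := by
  set c : ℕ → ℝ := fun t => nu (ζ t) θ with hc
  set ε := s ^ m with hε
  have hε0 : 0 < ε := pow_pos hs0 m
  set K := (1 / (2 * ε) + 2) * C with hK
  have hK0 : 0 ≤ K := by positivity
  have key : ∀ x : Tree, ∫⁻ y, ‖normSum θ c (splice m (x, y)) (m + 1)
      - normSum θ c (splice m (x, y)) m‖ₑ ∂treeLaw ζ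
      ≤ ENNReal.ofReal (ε / 2)
        + ENNReal.ofReal K * ENNReal.ofReal (normSum (p * θ) (fun t => p * c t) x m) := by
    intro x
    let a : List ℕ → ℝ := fun v => Real.exp (θ * position x v - ∑ t ∈ Finset.range m, c t)
    let g : List ℕ → Offspring → ℝ := fun v y => a v * (normOffspring θ (c m) y - 1)
    have hg : ∀ v, Measurable (g v) := fun v => by fun_prop
    have hdiff : ∀ y, normSum θ c (splice m (x, y)) (m + 1) - normSum θ c (splice m (x, y)) m
        = ∑ v ∈ generation x m, g v (y v) := by
      intro y
      rw [normSum_succ, normSum, generation_splice, ← Finset.sum_sub_distrib]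
      refine Finset.sum_congr rfl fun v hv => ?_
      rw [position_splice _ _ (length_of_mem_generation hv),
        splice_apply_of_length _ _ (length_of_mem_generation hv)]
      simp only [g, a]; ring
    have hind : iIndepFun (fun v (y : Tree) => g v (y v)) (treeLaw ζ) :=
      iIndepFun_infinitePi (P := fun v : List ℕ => ζ v.length) hg
    have hY : ∀ v, Measurable fun y : Tree => g v (y v) :=
      fun v => (hg v).comp (measurable_tree_apply v)
    have hmp : ∀ v ∈ generation x m, MeasurePreserving (fun y : Tree => y v) (treeLaw ζ) (ζ m) :=
      fun v hv => by
        have := measurePreserving_treeLaw_apply ζ v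
        rwa [length_of_mem_generation hv] at this
    have hm := h m le_rfl
    have hint : ∀ v ∈ generation x m, Integrable (fun y : Tree => g v (y v)) (treeLaw ζ) :=
      fun v hv => (hmp v hv).integrable_comp_of_integrable
        (((hm.integrable).sub (integrable_const 1)).const_mul (a v))
    have hmean : ∀ v ∈ generation x m, ∫ y, g v (y v) ∂treeLaw ζ = 0 := by
      intro v hv
      have := integral_map (μ := treeLaw ζ) (hmp v hv).measurable.aemeasurable
        (f := g v) (hg v).aestronglyMeasurable
      rw [← this, (hmp v hv).map_eq, integral_const_mul, integral_sub hm.integrable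
        (integrable_const 1), hm.mean]
      simp
    have hgp : ∀ v y, |g v y| ^ p = a v ^ p * |normOffspring θ (c m) y - 1| ^ p := by
      intro v y
      rw [abs_mul, Real.mul_rpow (abs_nonneg _) (abs_nonneg _), abs_of_pos (Real.exp_pos _)]
    have hintp : ∀ v ∈ generation x m, Integrable (fun y : Tree => |g v (y v)| ^ p) (treeLaw ζ) :=
      fun v hv => (hmp v hv).integrable_comp_of_integrable (g := fun y => |g v y| ^ p) (by
        simp_rw [hgp]; exact hm.integrable_rpow.const_mul _)
    have hmom : ∀ v ∈ generation x m, ∫ y, |g v (y v)| ^ p ∂treeLaw ζ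
        ≤ Real.exp (p * θ * position x v - ∑ t ∈ Finset.range m, p * c t) * C := by
      intro v hv
      have := integral_map (μ := treeLaw ζ) (hmp v hv).measurable.aemeasurable
        (f := fun y => |g v y| ^ p) ((hg v).abs.pow_const p).aestronglyMeasurable
      rw [← this, (hmp v hv).map_eq]
      simp_rw [hgp]
      rw [integral_const_mul]
      have ha : a v ^ p = Real.exp (p * θ * position x v - ∑ t ∈ Finset.range m, p * c t) := by
        rw [← Real.exp_mul, ← Finset.mul_sum]; ring_nf
      rw [ha]
      exact mul_le_mul_of_nonneg_left hm.moment (Real.exp_pos _).le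
    have hmain := integral_abs_sum_le_of_iIndepFun hY hind hp1 hp2 (generation x m) hint hmean
      hintp hε0
    simp_rw [hdiff]
    have hle : ∫ y, |∑ v ∈ generation x m, g v (y v)| ∂treeLaw ζ
        ≤ ε / 2 + K * normSum (p * θ) (fun t => p * c t) x m := by
      refine hmain.trans ?_
      have : K * normSum (p * θ) (fun t => p * c t) x m = (1 / (2 * ε) + 2) *
          ∑ v ∈ generation x m,
            Real.exp (p * θ * position x v - ∑ t ∈ Finset.range m, p * c t) * C := by
        rw [normSum, ← Finset.sum_mul, hK]; ring
      rw [this]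
      gcongr with v hv
      exact hmom v hv
    calc ∫⁻ y, ‖∑ v ∈ generation x m, g v (y v)‖ₑ ∂treeLaw ζ
        = ENNReal.ofReal (∫ y, |∑ v ∈ generation x m, g v (y v)| ∂treeLaw ζ) :=
          (ofReal_integral_norm_eq_lintegral_enorm (integrable_finsetSum _ hint)).symm
      _ ≤ ENNReal.ofReal (ε / 2 + K * normSum (p * θ) (fun t => p * c t) x m) :=
          ENNReal.ofReal_le_ofReal hle
      _ = _ := by
        rw [ENNReal.ofReal_add (by positivity) (mul_nonneg hK0 (normSum_nonneg _ _ _ _)),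
          ENNReal.ofReal_mul hK0]
  rw [lintegral_treeLaw_eq ζ m (by fun_prop)]
  refine (lintegral_mono key).trans ?_
  rw [lintegral_add_left measurable_const, lintegral_const_mul _ (by fun_prop),
    lintegral_normSum]
  have hprod : ∏ t ∈ Finset.range m,
      ∫⁻ y, ENNReal.ofReal (normOffspring (p * θ) (p * c t) y) ∂ζ t
      ≤ ENNReal.ofReal (ε ^ 2) := by
    calc _ ≤ ∏ t ∈ Finset.range m, ENNReal.ofReal (s ^ 2) :=
          Finset.prod_le_prod' fun t ht => (h t (Finset.mem_range.1 ht).le).contraction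
      _ = _ := by
        rw [Finset.prod_const, Finset.card_range, ← ENNReal.ofReal_pow (by positivity), hε]
        ring_nf
  refine (add_le_add le_rfl (mul_le_mul_right hprod _)).trans ?_
  rw [lintegral_const, measure_univ, mul_one, ← ENNReal.ofReal_mul hK0,
    ← ENNReal.ofReal_add (by positivity) (by positivity)]
  refine ENNReal.ofReal_le_ofReal ?_
  have h1 : K * ε ^ 2 = C / 2 * ε + 2 * C * ε ^ 2 := by rw [hK]; field_simp
  have h2 : ε ≤ 1 := pow_le_one₀ hs0.le hs1
  have h3 : C * ε ^ 2 ≤ C * ε := by gcongr; nlinarith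
  have h4 : 0 ≤ C * ε := by positivity
  rw [h1]
  nlinarith

/-! ### Geometric convergence in `L¹` -/

theorem tsum_ofReal_geometric {K s : ℝ} (hK : 0 ≤ K) (hs0 : 0 ≤ s) (hs1 : s < 1) (n : ℕ) :
    ∑' m, ENNReal.ofReal (K * s ^ (n + m)) = ENNReal.ofReal (K / (1 - s) * s ^ n) := by
  have hsum : HasSum (fun m => K * s ^ (n + m)) (K / (1 - s) * s ^ n) := by
    have := (hasSum_geometric_of_lt_one hs0 hs1).mul_left (K * s ^ n)
    have h1 : (fun m => K * s ^ (n + m)) = fun m => K * s ^ n * s ^ m := by ext m; ring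
    have h2 : K / (1 - s) * s ^ n = K * s ^ n * (1 - s)⁻¹ := by rw [div_eq_mul_inv]; ring
    rwa [h1, h2]
  rw [← hsum.tsum_eq, ENNReal.ofReal_tsum_of_nonneg (fun m => by positivity) hsum.summable]

section Geometric

variable {α : Type*} [MeasurableSpace α] {μ : Measure α} {f : ℕ → α → ℝ} {K s : ℝ}

theorem ae_exists_tendsto_of_geometric (hf : ∀ n, Measurable (f n)) (hK : 0 ≤ K) (hs0 : 0 ≤ s)
    (hs1 : s < 1)
    (h : ∀ n, ∫⁻ x, ‖f (n + 1) x - f n x‖ₑ ∂μ ≤ ENNReal.ofReal (K * s ^ n)) :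
    ∀ᵐ x ∂μ, ∃ l, Tendsto (fun n => f n x) atTop (𝓝 l) := by
  have hm : ∀ n, Measurable fun x => ‖f (n + 1) x - f n x‖ₑ :=
    fun n => ((hf (n + 1)).sub (hf n)).enorm
  have hfin : ∫⁻ x, ∑' n, ‖f (n + 1) x - f n x‖ₑ ∂μ ≠ ⊤ := by
    rw [lintegral_tsum fun n => (hm n).aemeasurable]
    refine ne_top_of_le_ne_top ?_ (ENNReal.tsum_le_tsum h)
    have := tsum_ofReal_geometric hK hs0 hs1 0
    simp only [zero_add] at this
    rw [this]
    exact ENNReal.ofReal_ne_top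
  filter_upwards [ae_lt_top (Measurable.tsum hm) hfin] with x hx
  refine cauchySeq_tendsto_of_complete
    (cauchySeq_of_edist_le_of_tsum_ne_top (fun n => ‖f (n + 1) x - f n x‖ₑ) (fun n => ?_) hx.ne)
  rw [edist_comm, edist_eq_enorm_sub]

theorem lintegral_sub_le_of_geometric (hf : ∀ n, Measurable (f n)) (hK : 0 ≤ K) (hs0 : 0 ≤ s)
    (hs1 : s < 1)
    (h : ∀ n, ∫⁻ x, ‖f (n + 1) x - f n x‖ₑ ∂μ ≤ ENNReal.ofReal (K * s ^ n))
    {g : α → ℝ} (hg : ∀ᵐ x ∂μ, Tendsto (fun n => f n x) atTop (𝓝 (g x))) (n : ℕ) :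
    ∫⁻ x, ‖g x - f n x‖ₑ ∂μ ≤ ENNReal.ofReal (K / (1 - s) * s ^ n) := by
  have hm : ∀ n, Measurable fun x => ‖f (n + 1) x - f n x‖ₑ :=
    fun n => ((hf (n + 1)).sub (hf n)).enorm
  calc ∫⁻ x, ‖g x - f n x‖ₑ ∂μ
      ≤ ∫⁻ x, ∑' m, ‖f (n + m + 1) x - f (n + m) x‖ₑ ∂μ := by
        refine lintegral_mono_ae ?_
        filter_upwards [hg] with x hx
        rw [← edist_eq_enorm_sub, edist_comm]
        refine edist_le_tsum_of_edist_le_of_tendsto (fun n => ‖f (n + 1) x - f n x‖ₑ)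
          (fun n => ?_) hx n
        rw [edist_comm, edist_eq_enorm_sub]
    _ = ∑' m, ∫⁻ x, ‖f (n + m + 1) x - f (n + m) x‖ₑ ∂μ :=
        lintegral_tsum fun m => (hm (n + m)).aemeasurable
    _ ≤ ∑' m, ENNReal.ofReal (K * s ^ (n + m)) := ENNReal.tsum_le_tsum fun m => h (n + m)
    _ = _ := tsum_ofReal_geometric hK hs0 hs1 n

/-- Freezing the sequence at time `n` reduces this to the infinite case. It is needed because the
moment bounds for the `n`-th process hold only before generation `n`. -/
theorem lintegral_sub_le_of_geometric_of_le (hf : ∀ n, Measurable (f n)) (hK : 0 ≤ K)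
    (hs0 : 0 ≤ s) (hs1 : s < 1) {n : ℕ}
    (h : ∀ m < n, ∫⁻ x, ‖f (m + 1) x - f m x‖ₑ ∂μ ≤ ENNReal.ofReal (K * s ^ m))
    {m : ℕ} (hmn : m ≤ n) :
    ∫⁻ x, ‖f n x - f m x‖ₑ ∂μ ≤ ENNReal.ofReal (K / (1 - s) * s ^ m) := by
  have := lintegral_sub_le_of_geometric (μ := μ) (f := fun j => f (min j n)) (g := f n)
    (fun j => hf _) hK hs0 hs1 (fun j => ?_) (ae_of_all _ fun x => ?_) m
  · simpa [hmn] using this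
  · rcases lt_or_ge j n with hj | hj
    · simpa [min_eq_left hj.le, min_eq_left (Nat.succ_le_of_lt hj)] using h j hj
    · simp [min_eq_right hj, min_eq_right (hj.trans (Nat.le_succ j))]
  · refine tendsto_const_nhds.congr' ?_
    filter_upwards [eventually_ge_atTop n] with j hj
    rw [min_eq_right hj]

end Geometric

/-! ### The limit of the normalised sums -/

theorem measurable_additiveMartingale (Z : Measure Offspring) (θ : ℝ) (m : ℕ) :
    Measurable fun x => additiveMartingale Z θ x m := by
  simp_rw [← normSum_const]
  fun_prop

theorem measurable_martingaleLimit (Z : Measure Offspring) (θ : ℝ) :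
    Measurable (martingaleLimit Z θ) :=
  (StronglyMeasurable.limUnder (l := atTop) (f := fun m x => additiveMartingale Z θ x m)
    fun m => (measurable_additiveMartingale Z θ m).stronglyMeasurable).measurable

section Limit

variable {Z : Measure Offspring} [IsProbabilityMeasure Z] {θ p s C : ℝ}

theorem lintegral_additiveMartingale_succ_sub_le (hp1 : 1 ≤ p) (hp2 : p ≤ 2) (hs0 : 0 < s)
    (hs1 : s < 1) (hC : 0 ≤ C) (hZ : MomentBounds θ p s C Z) (m : ℕ) :
    ∫⁻ x, ‖additiveMartingale Z θ x (m + 1) - additiveMartingale Z θ x m‖ₑ ∂treeLaw (fun _ => Z)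
      ≤ ENNReal.ofReal ((1 + 3 * C) * s ^ m) := by
  simp_rw [← normSum_const]
  exact lintegral_normSum_succ_sub_le (fun _ => Z) hp1 hp2 hs0 hs1.le hC fun _ _ => hZ

theorem ae_tendsto_martingaleLimit (hp1 : 1 ≤ p) (hp2 : p ≤ 2) (hs0 : 0 < s)
    (hs1 : s < 1) (hC : 0 ≤ C) (hZ : MomentBounds θ p s C Z) :
    ∀ᵐ x ∂treeLaw (fun _ => Z),
      Tendsto (additiveMartingale Z θ x) atTop (𝓝 (martingaleLimit Z θ x)) := by
  filter_upwards [ae_exists_tendsto_of_geometric (measurable_additiveMartingale Z θ)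
    (by positivity) hs0.le hs1
    (lintegral_additiveMartingale_succ_sub_le hp1 hp2 hs0 hs1 hC hZ)] with x hx
  exact tendsto_nhds_limUnder hx

theorem lintegral_martingaleLimit_sub_le (hp1 : 1 ≤ p) (hp2 : p ≤ 2) (hs0 : 0 < s)
    (hs1 : s < 1) (hC : 0 ≤ C) (hZ : MomentBounds θ p s C Z) (n : ℕ) :
    ∫⁻ x, ‖martingaleLimit Z θ x - additiveMartingale Z θ x n‖ₑ ∂treeLaw (fun _ => Z)
      ≤ ENNReal.ofReal ((1 + 3 * C) / (1 - s) * s ^ n) :=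
  lintegral_sub_le_of_geometric (measurable_additiveMartingale Z θ) (by positivity) hs0.le hs1
    (lintegral_additiveMartingale_succ_sub_le hp1 hp2 hs0 hs1 hC hZ)
    (ae_tendsto_martingaleLimit hp1 hp2 hs0 hs1 hC hZ) n

theorem additiveMartingale_nonneg (Z : Measure Offspring) (θ : ℝ) (x : Tree) (m : ℕ) :
    0 ≤ additiveMartingale Z θ x m :=
  Finset.sum_nonneg fun _ _ => (Real.exp_pos _).le

theorem normOffspring_nonneg (θ c : ℝ) (y : Offspring) : 0 ≤ normOffspring θ c y :=
  Finset.sum_nonneg fun _ _ => (Real.exp_pos _).le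

theorem lintegral_additiveMartingale (hZ : MomentBounds θ p s C Z) (m : ℕ) :
    ∫⁻ x, ENNReal.ofReal (additiveMartingale Z θ x m) ∂treeLaw (fun _ => Z) = 1 := by
  simp_rw [← normSum_const]
  rw [lintegral_normSum, ← ofReal_integral_eq_lintegral_ofReal hZ.integrable
    (ae_of_all _ fun y => normOffspring_nonneg _ _ y), hZ.mean]
  simp

theorem integrable_additiveMartingale (hZ : MomentBounds θ p s C Z) (m : ℕ) :
    Integrable (fun x => additiveMartingale Z θ x m) (treeLaw (fun _ => Z)) := by
  refine ⟨(measurable_additiveMartingale Z θ m).aestronglyMeasurable, ?_⟩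
  rw [hasFiniteIntegral_iff_ofReal (ae_of_all _ fun x => additiveMartingale_nonneg Z θ x m),
    lintegral_additiveMartingale hZ]
  exact ENNReal.one_lt_top

theorem integral_additiveMartingale (hZ : MomentBounds θ p s C Z) (m : ℕ) :
    ∫ x, additiveMartingale Z θ x m ∂treeLaw (fun _ => Z) = 1 := by
  rw [integral_eq_lintegral_of_nonneg_ae (ae_of_all _ fun x => additiveMartingale_nonneg Z θ x m)
    (measurable_additiveMartingale Z θ m).aestronglyMeasurable, lintegral_additiveMartingale hZ]
  simp

theorem integrable_martingaleLimit (hp1 : 1 ≤ p) (hp2 : p ≤ 2) (hs0 : 0 < s)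
    (hs1 : s < 1) (hC : 0 ≤ C) (hZ : MomentBounds θ p s C Z) :
    Integrable (martingaleLimit Z θ) (treeLaw (fun _ => Z)) := by
  have h : Integrable (fun x => martingaleLimit Z θ x - additiveMartingale Z θ x 0)
      (treeLaw (fun _ => Z)) :=
    ⟨((measurable_martingaleLimit Z θ).sub
      (measurable_additiveMartingale Z θ 0)).aestronglyMeasurable,
      (lintegral_martingaleLimit_sub_le hp1 hp2 hs0 hs1 hC hZ 0).trans_lt ENNReal.ofReal_lt_top⟩
  exact (h.add (integrable_additiveMartingale hZ 0)).congr (ae_of_all _ fun x => by simp)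

/-- The mean survives because the convergence is in `L¹`; almost sure convergence alone could lose
mass. -/
theorem integral_martingaleLimit (hp1 : 1 ≤ p) (hp2 : p ≤ 2) (hs0 : 0 < s)
    (hs1 : s < 1) (hC : 0 ≤ C) (hZ : MomentBounds θ p s C Z) :
    ∫ x, martingaleLimit Z θ x ∂treeLaw (fun _ => Z) = 1 := by
  have h := tendsto_integral_of_L1 (l := atTop) (martingaleLimit Z θ)
    (integrable_martingaleLimit hp1 hp2 hs0 hs1 hC hZ).aestronglyMeasurable
    (F := fun m x => additiveMartingale Z θ x m)
    (Eventually.of_forall fun m => integrable_additiveMartingale hZ m) ?_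
  · simp_rw [integral_additiveMartingale hZ] at h
    exact (tendsto_nhds_unique h tendsto_const_nhds)
  · have hlim : Tendsto (fun m => ENNReal.ofReal ((1 + 3 * C) / (1 - s) * s ^ m)) atTop (𝓝 0) := by
      have := (tendsto_pow_atTop_nhds_zero_of_lt_one hs0.le hs1).const_mul
        ((1 + 3 * C) / (1 - s))
      simpa using ENNReal.tendsto_ofReal this
    refine tendsto_of_tendsto_of_tendsto_of_le_of_le tendsto_const_nhds hlim
      (fun _ => zero_le) fun m => ?_
    refine le_of_eq_of_le ?_ (lintegral_martingaleLimit_sub_le hp1 hp2 hs0 hs1 hC hZ m)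
    refine lintegral_congr fun x => ?_
    rw [← edist_eq_enorm_sub, edist_comm, edist_eq_enorm_sub]

/-! ### The recursive distributional equation -/

/-- The map `((N, ξ), Δ) ↦ ∑_{j < N} exp (θ ξ_j - ν(θ)) Δ_j`. -/
noncomputable def smoothing (Z : Measure Offspring) (θ : ℝ) (q : Offspring × (ℕ → ℝ)) : ℝ :=
  ∑ j ∈ Finset.range q.1.1, Real.exp (θ * q.1.2 j - nu Z θ) * q.2 j

@[fun_prop]
theorem measurable_smoothing (Z : Measure Offspring) (θ : ℝ) : Measurable (smoothing Z θ) :=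
  measurable_range_sum (by fun_prop) fun j => by fun_prop

@[fun_prop]
theorem measurable_subtree (j : ℕ) : Measurable (subtree j) :=
  measurable_pi_lambda _ fun v => measurable_tree_apply (v ++ [j])

/-- The words `v ++ [j]` are distinct for distinct pairs `(j, v)`, so the subtrees read disjoint
families of independent coordinates. -/
theorem map_subtree (Z : Measure Offspring) [IsProbabilityMeasure Z] :
    (treeLaw fun _ => Z).map (fun x j => subtree j x)
      = Measure.infinitePi fun _ : ℕ => treeLaw fun _ => Z := by
  have hinj : Function.Injective fun q : ℕ × List ℕ => q.2 ++ [q.1] := by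
    rintro ⟨i, u⟩ ⟨j, v⟩ h
    have := List.append_inj' h rfl
    simp_all
  have h1 := Measure.map_infinitePi_infinitePi_of_inj (P := fun _ : List ℕ => Z) hinj
  have h2 := Measure.infinitePi_map_curry fun (_ : ℕ) (_ : List ℕ) => Z
  rw [← h1, Measure.map_map (by fun_prop) (by fun_prop)] at h2
  exact h2

theorem map_root_subtree (Z : Measure Offspring) [IsProbabilityMeasure Z] :
    (treeLaw fun _ => Z).map (fun x => (x [], fun j => subtree j x))
      = Z.prod (Measure.infinitePi fun _ : ℕ => treeLaw fun _ => Z) := by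
  have hroot : Measurable fun x : Tree => x [] := measurable_tree_apply []
  have hsub : Measurable fun (x : Tree) (j : ℕ) => subtree j x := by fun_prop
  -- Splicing at generation 1 makes the root and the subtrees functions of two independent trees.
  conv_lhs => rw [← map_splice (fun _ => Z) 1]
  rw [Measure.map_map (hroot.prodMk hsub) (by fun_prop)]
  have : (fun x : Tree => (x [], fun j => subtree j x)) ∘ splice 1
      = Prod.map (fun x : Tree => x []) (fun x j => subtree j x) := by
    ext1 ⟨x, y⟩
    refine Prod.ext (by simp [splice]) ?_
    ext1 j
    ext1 v
    simp [splice, subtree]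
  rw [this, ← Measure.map_prod_map _ _ hroot hsub, map_subtree,
    (measurePreserving_treeLaw_apply (fun _ => Z) []).map_eq]

theorem isMeanOneSolution_map_martingaleLimit (hp1 : 1 ≤ p) (hp2 : p ≤ 2) (hs0 : 0 < s)
    (hs1 : s < 1) (hC : 0 ≤ C) (hZ : MomentBounds θ p s C Z) :
    IsMeanOneSolution Z θ ((treeLaw fun _ => Z).map (martingaleLimit Z θ)) where
  prob := Measure.isProbabilityMeasure_map (measurable_martingaleLimit Z θ).aemeasurable
  integrable := (integrable_map_measure (f := martingaleLimit Z θ) (g := fun y : ℝ => y)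
    measurable_id.aestronglyMeasurable (measurable_martingaleLimit Z θ).aemeasurable).2
    (integrable_martingaleLimit hp1 hp2 hs0 hs1 hC hZ)
  mean := by
    rw [integral_map (f := fun y : ℝ => y) (measurable_martingaleLimit Z θ).aemeasurable
      measurable_id.aestronglyMeasurable]
    exact integral_martingaleLimit hp1 hp2 hs0 hs1 hC hZ
  fixed := by
    change Measure.map (smoothing Z θ) _ = _
    have hM := measurable_martingaleLimit Z θ
    rw [← Measure.infinitePi_map_pi (μ := fun _ : ℕ => treeLaw fun _ => Z)
      (f := fun _ => martingaleLimit Z θ) fun _ => hM]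
    have hM' : Measurable fun (x : ℕ → Tree) j => martingaleLimit Z θ (x j) := by fun_prop
    have hid := Measure.map_prod_map Z (Measure.infinitePi fun _ : ℕ => treeLaw fun _ => Z)
      measurable_id hM'
    rw [Measure.map_id] at hid
    have hroot : Measurable fun x : Tree => (x [], fun j => subtree j x) :=
      (measurable_tree_apply []).prodMk (by fun_prop)
    rw [hid, ← map_root_subtree,
      Measure.map_map (measurable_id.prodMap hM') hroot,
      Measure.map_map (measurable_smoothing Z θ) ((measurable_id.prodMap hM').comp hroot)]
    -- Both laws are now images of the same tree law, so an almost sure identity suffices: the limit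
    -- of `additiveMartingale_succ`.
    refine Measure.map_congr ?_
    have hconv := ae_tendsto_martingaleLimit hp1 hp2 hs0 hs1 hC hZ
    have hsub : ∀ᵐ x ∂treeLaw (fun _ => Z), ∀ j, Tendsto (additiveMartingale Z θ (subtree j x))
        atTop (𝓝 (martingaleLimit Z θ (subtree j x))) := by
      rw [ae_all_iff]
      intro j
      have hmp : (treeLaw fun _ => Z).map (subtree j) = treeLaw fun _ => Z := by
        have h1 := Measure.infinitePi_map_eval (fun _ : ℕ => treeLaw fun _ => Z) j
        rw [← map_subtree, Measure.map_map (measurable_pi_apply j) (by fun_prop)] at h1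
        exact h1
      rw [← hmp] at hconv
      exact ae_of_ae_map (by fun_prop) hconv
    filter_upwards [hconv, hsub] with x hx hsx
    refine tendsto_nhds_unique ?_ ((tendsto_add_atTop_iff_nat 1).2 hx)
    simp_rw [additiveMartingale_succ]
    exact tendsto_finsetSum _ fun j _ => (hsx j).const_mul _

theorem ae_martingaleLimit_nonneg (hp1 : 1 ≤ p) (hp2 : p ≤ 2) (hs0 : 0 < s)
    (hs1 : s < 1) (hC : 0 ≤ C) (hZ : MomentBounds θ p s C Z) :
    ∀ᵐ x ∂treeLaw (fun _ => Z), 0 ≤ martingaleLimit Z θ x := by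
  filter_upwards [ae_tendsto_martingaleLimit hp1 hp2 hs0 hs1 hC hZ] with x hx
  exact ge_of_tendsto' hx fun m => additiveMartingale_nonneg Z θ x m

end Limit

/-! ### Positivity of the limit. -/

theorem IsMeanOneSolution.measure_singleton_zero {Z : Measure Offspring} [IsProbabilityMeasure Z]
    {θ : ℝ} {ρ : Measure ℝ} (h : IsMeanOneSolution Z θ ρ) (hZ : Admissible Z)
    (hρ : ∀ᵐ y ∂ρ, 0 ≤ y) : ρ {0} = 0 := by
  have := h.prob
  set u := ρ {0} with hu
  have hu1 : u ≤ 1 := prob_le_one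
  have hnn : ∀ᵐ y ∂Measure.infinitePi (fun _ : ℕ => ρ), ∀ j, 0 ≤ y j := by
    rw [ae_all_iff]
    intro j
    have := Measure.infinitePi_map_eval (fun _ : ℕ => ρ) j
    rw [← this] at hρ
    exact ae_of_ae_map (measurable_pi_apply j).aemeasurable hρ
  -- A sum of nonnegative terms with positive weights vanishes only if every term does.
  have hrec : u = ∫⁻ x, u ^ x.1 ∂Z := by
    have hfix : ρ = (Z.prod (Measure.infinitePi fun _ : ℕ => ρ)).map (smoothing Z θ) := h.fixed.symm
    have hms := measurableSet_singleton (0 : ℝ)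
    conv_lhs => rw [hu, hfix, Measure.map_apply (measurable_smoothing Z θ) hms,
      Measure.prod_apply (measurable_smoothing Z θ hms)]
    refine lintegral_congr fun x => ?_
    have hpi : Measure.infinitePi (fun _ : ℕ => ρ) (Set.pi (Finset.range x.1) fun _ => {0})
        = u ^ x.1 := by
      rw [Measure.infinitePi_pi _ fun _ _ => hms]
      simp [hu]
    rw [← hpi]
    refine measure_congr ?_
    filter_upwards [hnn] with y hy
    refine propext ?_
    change (∑ j ∈ Finset.range x.1, Real.exp (θ * x.2 j - nu Z θ) * y j = 0) ↔ _
    rw [Finset.sum_eq_zero_iff_of_nonneg fun j _ => mul_nonneg (Real.exp_pos _).le (hy j)]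
    simp [Real.exp_ne_zero]
    rfl
  -- As `u ≤ 1` and `N ≥ 1`, `u ^ N ≤ u`. Equality of the integrals forces equality almost
  -- everywhere, including at some `N ≥ 2`, so `u` is `0` or `1`; mean one rules out `1`.
  have hle : (fun x : Offspring => u ^ x.1) ≤ᵐ[Z] fun _ => u := by
    filter_upwards [hZ.no_extinction] with x hx
    calc u ^ x.1 ≤ u ^ 1 := pow_le_pow_right_of_le_one' hu1 hx
      _ = u := pow_one u
  have heq : (fun x : Offspring => u ^ x.1) =ᵐ[Z] fun _ => u := by
    refine ae_eq_of_ae_le_of_lintegral_le hle ?_ aemeasurable_const ?_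
    · rw [← hrec]; exact ne_top_of_le_ne_top ENNReal.one_ne_top hu1
    · rw [← hrec]; simp
  have hN : ∃ x : Offspring, u ^ x.1 = u ∧ 1 ≤ x.1 ∧ x.1 ≠ 1 := by
    by_contra hcon
    push Not at hcon
    refine hZ.number_nontrivial.ne ?_
    have : ∀ᵐ x ∂Z, x ∈ {x : Offspring | x.1 = 1} := by
      filter_upwards [heq, hZ.no_extinction] with x hx hx1 using hcon x hx hx1
    exact (prob_compl_eq_zero_iff (measurable_fst (measurableSet_singleton 1))).1 this
  obtain ⟨x, hx, hx1, hx2⟩ := hN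
  by_contra hu0
  have hu_one : u = 1 := by
    obtain ⟨k, hk⟩ : ∃ k, x.1 = k + 1 + 1 := ⟨x.1 - 2, by omega⟩
    rw [hk, pow_succ] at hx
    have h2 : u ^ (k + 1) * u = 1 * u := by rw [hx, one_mul]
    have h3 := (ENNReal.mul_left_inj hu0 (ne_top_of_le_ne_top ENNReal.one_ne_top hu1)).1 h2
    refine hu1.antisymm ?_
    calc 1 = u ^ (k + 1) := h3.symm
      _ ≤ u ^ 1 := pow_le_pow_right_of_le_one' hu1 (by omega)
      _ = u := pow_one u
  have hae : ∀ᵐ y ∂ρ, y = 0 := (prob_compl_eq_zero_iff (measurableSet_singleton 0)).2 hu_one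
  have hmean := h.mean
  rw [integral_congr_ae (g := fun _ => (0 : ℝ)) hae] at hmean
  simp at hmean

/-! ### Uniqueness of the solution of the recursive distributional equation -/

theorem norm_prod_range_sub_prod_le {a b : ℕ → ℂ} (ha : ∀ j, ‖a j‖ ≤ 1) (hb : ∀ j, ‖b j‖ ≤ 1)
    (n : ℕ) : ‖∏ j ∈ Finset.range n, a j - ∏ j ∈ Finset.range n, b j‖
      ≤ ∑ j ∈ Finset.range n, ‖a j - b j‖ := by
  induction n with
  | zero => simp
  | succ n ih =>
    have hB : ‖∏ j ∈ Finset.range n, b j‖ ≤ 1 := by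
      rw [norm_prod]
      exact Finset.prod_le_one (fun _ _ => norm_nonneg _) fun j _ => hb j
    rw [Finset.prod_range_succ, Finset.prod_range_succ, Finset.sum_range_succ]
    have : (∏ j ∈ Finset.range n, a j) * a n - (∏ j ∈ Finset.range n, b j) * b n
        = (∏ j ∈ Finset.range n, a j - ∏ j ∈ Finset.range n, b j) * a n
          + (∏ j ∈ Finset.range n, b j) * (a n - b n) := by ring
    rw [this]
    refine (norm_add_le _ _).trans (add_le_add ?_ ?_)
    · rw [norm_mul]
      exact (mul_le_of_le_one_right (norm_nonneg _) (ha n)).trans ih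
    · rw [norm_mul]
      exact mul_le_of_le_one_left (norm_nonneg _) hB

section

variable {Z : Measure Offspring} [IsProbabilityMeasure Z] {θ : ℝ} {ρ : Measure ℝ}

theorem IsMeanOneSolution.integrable_prod_charFun (h : IsMeanOneSolution Z θ ρ) (t : ℝ) :
    Integrable (fun x : Offspring =>
      ∏ j ∈ Finset.range x.1, charFun ρ (Real.exp (θ * x.2 j - nu Z θ) * t)) Z := by
  have := h.prob
  refine Integrable.of_bound (C := 1) (Measurable.aestronglyMeasurable ?_) (ae_of_all _ fun x => ?_)
  · refine measurable_comp_of_countable (F := fun n (x : Offspring) =>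
      ∏ j ∈ Finset.range n, charFun ρ (Real.exp (θ * x.2 j - nu Z θ) * t)) (fun n => ?_)
      (g := fun x => x.1) fun n => measurable_fst (measurableSet_singleton n)
    refine Finset.measurable_fun_prod _ fun j _ => ?_
    exact continuous_charFun.measurable.comp (by fun_prop)
  · rw [norm_prod]
    exact Finset.prod_le_one (fun _ _ => norm_nonneg _) fun j _ => norm_charFun_le_one _

theorem IsMeanOneSolution.charFun_eq (h : IsMeanOneSolution Z θ ρ) (t : ℝ) :
    charFun ρ t = ∫ x, ∏ j ∈ Finset.range x.1,
      charFun ρ (Real.exp (θ * x.2 j - nu Z θ) * t) ∂Z := by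
  have := h.prob
  have hfix : ρ = (Z.prod (Measure.infinitePi fun _ : ℕ => ρ)).map (smoothing Z θ) := h.fixed.symm
  have hexp : Measurable fun u : ℝ => Complex.exp (t * u * Complex.I) := by fun_prop
  conv_lhs => rw [hfix, charFun_apply_real,
    integral_map (measurable_smoothing Z θ).aemeasurable hexp.aestronglyMeasurable]
  rw [integral_prod]
  swap
  · refine Integrable.of_bound (C := 1)
      (hexp.comp (measurable_smoothing Z θ)).aestronglyMeasurable (ae_of_all _ fun q => ?_)
    rw [← Complex.ofReal_mul, Complex.norm_exp_ofReal_mul_I]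
  refine integral_congr_ae (ae_of_all _ fun x => ?_)
  have hsm : Measurable fun y : ℕ → ℝ => smoothing Z θ (x, y) :=
    (measurable_smoothing Z θ).comp (by fun_prop)
  change ∫ y, Complex.exp (t * (smoothing Z θ (x, y) : ℝ) * Complex.I)
    ∂Measure.infinitePi (fun _ : ℕ => ρ) = _
  have h1 := integral_map (μ := Measure.infinitePi fun _ : ℕ => ρ) hsm.aemeasurable
    (f := fun u : ℝ => Complex.exp (t * u * Complex.I)) hexp.aestronglyMeasurable
  rw [← h1, ← charFun_apply_real]
  have hind : iIndepFun (fun j (y : ℕ → ℝ) => Real.exp (θ * x.2 j - nu Z θ) * y j)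
      (Measure.infinitePi fun _ : ℕ => ρ) :=
    iIndepFun_infinitePi (P := fun _ : ℕ => ρ)
      (X := fun j u => Real.exp (θ * x.2 j - nu Z θ) * u) fun j => by fun_prop
  have h2 := iIndepFun.charFun_map_fun_finsetSum_eq_prod (s := Finset.range x.1)
    (fun j _ => (show Measurable fun y : ℕ → ℝ => Real.exp (θ * x.2 j - nu Z θ) * y j by
      fun_prop).aemeasurable) (hind.restrict _)
  have h3 := congrFun h2 t
  rw [Finset.prod_apply] at h3
  refine Eq.trans ?_ (h3.trans (Finset.prod_congr rfl fun j _ => ?_))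
  · rfl
  · rw [charFun_map_mul_comp (f := fun y : ℕ → ℝ => y j) (measurable_pi_apply j).aemeasurable]
    congr 1
    exact Measure.infinitePi_map_eval (fun _ : ℕ => ρ) j

omit [IsProbabilityMeasure Z] in
-- The mean enters uniqueness only here: the characteristic functions of two solutions agree to
-- first order at `0`.
theorem IsMeanOneSolution.hasDerivAt_charFun (h : IsMeanOneSolution Z θ ρ) :
    HasDerivAt (charFun ρ) Complex.I 0 := by
  have := h.prob
  have hL : MemLp id (1 : ℕ) ρ := by
    rw [Nat.cast_one, memLp_one_iff_integrable]
    exact h.integrable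
  have hd : DifferentiableAt ℝ (charFun ρ) 0 :=
    (contDiff_charFun hL).differentiable (by simp) 0
  have := iteratedDeriv_charFun_zero hL
  rw [iteratedDeriv_one] at this
  rw [show Complex.I = deriv (charFun ρ) 0 by rw [this]; simp [h.mean]]
  exact hd.hasDerivAt

variable {ρ' : Measure ℝ} {p s C : ℝ}

omit [IsProbabilityMeasure Z] in
theorem integrable_normOffspring_rpow (hZ : MomentBounds θ p s C Z) :
    Integrable (normOffspring (p * θ) (p * nu Z θ)) Z := by
  refine ⟨(by fun_prop), ?_⟩
  rw [hasFiniteIntegral_iff_ofReal (ae_of_all _ fun x => normOffspring_nonneg _ _ x)]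
  exact hZ.contraction.trans_lt ENNReal.ofReal_lt_top

omit [IsProbabilityMeasure Z] in
theorem integral_normOffspring_rpow_le (hZ : MomentBounds θ p s C Z) :
    ∫ x, normOffspring (p * θ) (p * nu Z θ) x ∂Z ≤ s ^ 2 := by
  rw [← ENNReal.ofReal_le_ofReal_iff (by positivity), ofReal_integral_eq_lintegral_ofReal
    (integrable_normOffspring_rpow hZ) (ae_of_all _ fun x => normOffspring_nonneg _ _ x)]
  exact hZ.contraction

/-- One application of the recursive equation preserves the linear term, since the weights have
total mean one, and shrinks the term of order `p` by `s ^ 2`. -/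
theorem IsMeanOneSolution.norm_charFun_sub_le (hZ : MomentBounds θ p s C Z)
    (h : IsMeanOneSolution Z θ ρ) (h' : IsMeanOneSolution Z θ ρ') {ε B : ℝ} (hB : 0 ≤ B)
    (hle : ∀ t, ‖charFun ρ t - charFun ρ' t‖ ≤ ε * |t| + B * |t| ^ p) (t : ℝ) :
    ‖charFun ρ t - charFun ρ' t‖ ≤ ε * |t| + B * s ^ 2 * |t| ^ p := by
  have := h.prob
  have := h'.prob
  have hint : Integrable (fun x => ε * |t| * normOffspring θ (nu Z θ) x
      + B * |t| ^ p * normOffspring (p * θ) (p * nu Z θ) x) Z :=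
    (hZ.integrable.const_mul _).add ((integrable_normOffspring_rpow hZ).const_mul _)
  rw [h.charFun_eq t, h'.charFun_eq t,
    ← integral_sub (h.integrable_prod_charFun t) (h'.integrable_prod_charFun t)]
  refine (norm_integral_le_of_norm_le hint (ae_of_all _ fun x => ?_)).trans ?_
  · refine (norm_prod_range_sub_prod_le (fun j => norm_charFun_le_one _)
      (fun j => norm_charFun_le_one _) _).trans ?_
    rw [normOffspring, normOffspring, Finset.mul_sum, Finset.mul_sum, ← Finset.sum_add_distrib]
    refine Finset.sum_le_sum fun j _ => (hle _).trans (le_of_eq ?_)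
    rw [abs_mul, abs_of_pos (Real.exp_pos _), Real.mul_rpow (Real.exp_pos _).le (abs_nonneg _),
      ← Real.exp_mul]
    ring_nf
  · rw [integral_add (hZ.integrable.const_mul _)
      ((integrable_normOffspring_rpow hZ).const_mul _), integral_const_mul, integral_const_mul,
      hZ.mean]
    have := mul_le_mul_of_nonneg_left (integral_normOffspring_rpow_le hZ)
      (show 0 ≤ B * |t| ^ p by positivity)
    linarith

/-- With only a first moment, the difference of characteristic functions is `o(|t|)` at `0`, not
`O(|t| ^ p)`. Starting from a bound `ε |t| + B |t| ^ p`, iteration removes the second term, and then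
`ε` tends to `0`. -/
theorem IsMeanOneSolution.eq (hp1 : 1 < p) (hs0 : 0 < s) (hs1 : s < 1)
    (hZ : MomentBounds θ p s C Z)
    (h : IsMeanOneSolution Z θ ρ) (h' : IsMeanOneSolution Z θ ρ') : ρ = ρ' := by
  have := h.prob
  have := h'.prob
  refine Measure.ext_of_charFun (funext fun t => ?_)
  rw [← sub_eq_zero, ← norm_le_zero_iff]
  have hlin : ∀ ε > 0, ‖charFun ρ t - charFun ρ' t‖ ≤ ε * |t| := by
    intro ε hε
    have hd : HasDerivAt (fun u => charFun ρ u - charFun ρ' u) 0 0 := by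
      have := h.hasDerivAt_charFun.sub h'.hasDerivAt_charFun
      rwa [sub_self] at this
    have ho := (hasDerivAt_iff_isLittleO_nhds_zero.1 hd).def hε
    simp only [zero_add, charFun_zero, probReal_univ, sub_self, sub_zero, smul_zero] at ho
    obtain ⟨δ, hδ, hball⟩ := Metric.eventually_nhds_iff.1 ho
    have hstart : ∃ B, 0 ≤ B ∧ ∀ u, ‖charFun ρ u - charFun ρ' u‖ ≤ ε * |u| + B * |u| ^ p := by
      -- The derivative handles `|u| < δ`; elsewhere the difference is at most `2`, and `|u| ^ p ≥ δ
      -- ^ p`.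
      refine ⟨2 / δ ^ p, by positivity, fun u => ?_⟩
      have hu : 0 ≤ |u| ^ p := by positivity
      rcases lt_or_ge |u| δ with hlt | hge
      · have := hball (y := u) (by simpa using hlt)
        rw [Real.norm_eq_abs] at this
        exact this.trans (le_add_of_nonneg_right (by positivity))
      · have h1 : δ ^ p ≤ |u| ^ p := Real.rpow_le_rpow hδ.le hge (by linarith)
        have h2 : ‖charFun ρ u - charFun ρ' u‖ ≤ 2 := by
          refine (norm_sub_le _ _).trans ?_
          linarith [norm_charFun_le_one (μ := ρ) u, norm_charFun_le_one (μ := ρ') u]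
        have h3 : 2 ≤ 2 / δ ^ p * |u| ^ p := by
          rw [div_mul_eq_mul_div, le_div_iff₀ (by positivity)]
          linarith
        have : 0 ≤ ε * |u| := by positivity
        linarith
    obtain ⟨B, hB, hstart⟩ := hstart
    have hiter : ∀ m : ℕ, ∀ u, ‖charFun ρ u - charFun ρ' u‖
        ≤ ε * |u| + B * (s ^ 2) ^ m * |u| ^ p := by
      intro m
      induction m with
      | zero => simpa using hstart
      | succ m ih =>
        intro u
        have := h.norm_charFun_sub_le hZ h' (by positivity) ih u
        rwa [mul_assoc B, ← pow_succ] at this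
    have hlim : Tendsto (fun m : ℕ => ε * |t| + B * (s ^ 2) ^ m * |t| ^ p) atTop
        (𝓝 (ε * |t| + B * 0 * |t| ^ p)) :=
      (((tendsto_pow_atTop_nhds_zero_of_lt_one (by positivity)
        (by nlinarith)).const_mul B).mul_const _).const_add _
    simpa using ge_of_tendsto' hlim fun m => hiter m t
  refine le_of_forall_pos_le_add fun η hη => ?_
  have := hlin (η / (|t| + 1)) (by positivity)
  refine this.trans ?_
  rw [div_mul_eq_mul_div, div_le_iff₀ (by positivity)]
  nlinarith [abs_nonneg t]

end

/-! ### The exponential modification of the last generation -/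

theorem ae_expMeasure_one_pos : ∀ᵐ u ∂expMeasure 1, 0 < u := by
  have := isProbabilityMeasure_expMeasure one_pos
  rw [ae_iff]
  simp only [not_lt]
  change expMeasure 1 (Set.Iic 0) = 0
  rw [← ofReal_cdf, cdf_expMeasure_eq one_pos]
  simp

theorem expMeasure_one_Ici {t : ℝ} (ht : 0 < t) :
    expMeasure 1 (Set.Ici t) = ENNReal.ofReal (Real.exp (-t)) := by
  have := isProbabilityMeasure_expMeasure one_pos
  have hna : NullSingletonClass (expMeasure 1) := by
    unfold expMeasure gammaMeasure
    infer_instance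
  rw [← measure_congr Ioi_ae_eq_Ici, ← Set.compl_Iic, prob_compl_eq_one_sub measurableSet_Iic,
    ← ofReal_cdf, cdf_expMeasure_eq one_pos, if_pos ht.le, ← ENNReal.ofReal_one,
    ← ENNReal.ofReal_sub _ (by simp [ht.le])]
  simp

/-- The law of `-(1 / θ) log E` for an exponential random variable `E`. -/
theorem map_log_exp_Iic {θ : ℝ} (hθ : 0 < θ) (y : ℝ) :
    (expMeasure 1).map (fun u => 1 / θ * (-Real.log u)) (Set.Iic y)
      = ENNReal.ofReal (Real.exp (-Real.exp (-(θ * y)))) := by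
  rw [Measure.map_apply (by fun_prop) measurableSet_Iic, ← expMeasure_one_Ici (Real.exp_pos _)]
  refine measure_congr ?_
  filter_upwards [ae_expMeasure_one_pos] with u hu
  refine propext ?_
  change 1 / θ * (-Real.log u) ≤ y ↔ Real.exp (-(θ * y)) ≤ u
  rw [← Real.le_log_iff_exp_le hu, one_div, inv_mul_le_iff₀ hθ]
  constructor <;> intro h <;> linarith

/-- The right-most position centred by its deterministic drift and by the logarithm of the
normalised sum. -/
noncomputable def centredRightmost (θ : ℝ) (c : ℕ → ℝ) (n : ℕ) (q : Tree × (List ℕ → ℝ)) : ℝ :=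
  rightmost θ q.1 q.2 n - (∑ t ∈ Finset.range n, c t) / θ - 1 / θ * Real.log (normSum θ c q.1 n)

theorem measurable_rightmost (θ : ℝ) (n : ℕ) :
    Measurable fun q : Tree × (List ℕ → ℝ) => rightmost θ q.1 q.2 n := by
  refine measurable_generation_comp (X := fun q : Tree × (List ℕ → ℝ) => q.1)
    (F := fun s (q : Tree × (List ℕ → ℝ)) =>
      sSup ((fun v => position q.1 v + 1 / θ * (-Real.log (q.2 v))) '' (s : Set (List ℕ))))
    (fun s => ?_) measurable_fst n
  rcases s.eq_empty_or_nonempty with rfl | hs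
  · simp
  · simp_rw [← Finset.sup'_eq_csSup_image s hs]
    have := Finset.measurable_sup' hs (f := fun v (q : Tree × (List ℕ → ℝ)) =>
      position q.1 v + 1 / θ * (-Real.log (q.2 v))) fun v _ => by
        refine ((measurable_position v).comp measurable_fst).add ?_
        exact (Real.measurable_log.comp
          ((measurable_pi_apply v).comp measurable_snd)).neg.const_mul _
    convert this using 1
    ext q
    simp

theorem measurable_centredRightmost (θ : ℝ) (c : ℕ → ℝ) (n : ℕ) :
    Measurable (centredRightmost θ c n) := by
  refine ((measurable_rightmost θ n).sub_const _).sub (Measurable.const_mul ?_ _)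
  exact Real.measurable_log.comp ((measurable_normSum θ c n).comp measurable_fst)

theorem normSum_pos {θ : ℝ} {c : ℕ → ℝ} {x : Tree} {n : ℕ} (h : (generation x n).Nonempty) :
    0 < normSum θ c x n :=
  Finset.sum_pos (fun _ _ => Real.exp_pos _) h

/-- For a fixed tree the modified right-most position, suitably centred, has an explicit law. -/
theorem measure_centredRightmost_le {θ : ℝ} (hθ : 0 < θ) (c : ℕ → ℝ) {n : ℕ} {x : Tree}
    (hx : (generation x n).Nonempty) (y : ℝ) :
    Measure.infinitePi (fun _ : List ℕ => expMeasure 1) {e | centredRightmost θ c n (x, e) ≤ y}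
      = ENNReal.ofReal (Real.exp (-Real.exp (-(θ * y)))) := by
  have := isProbabilityMeasure_expMeasure one_pos
  set s := ∑ t ∈ Finset.range n, c t
  set D := normSum θ c x n with hD
  have hDpos : 0 < D := normSum_pos hx
  -- The bound on the maximum says `e v ≥ τ v` for all `v`. Dividing by `D` makes the thresholds sum
  -- to `exp (-θ y)`, whatever the tree.
  let τ : List ℕ → ℝ := fun v =>
    Real.exp (θ * position x v - s) * (Real.exp (-(θ * y)) / D)
  have hτ : ∀ v, 0 < τ v := fun v => by positivity
  have hpos : ∀ᵐ e ∂Measure.infinitePi (fun _ : List ℕ => expMeasure 1), ∀ v, 0 < e v := by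
    rw [ae_all_iff]
    intro v
    have hv := Measure.infinitePi_map_eval (fun _ : List ℕ => expMeasure 1) v
    have hpos := ae_expMeasure_one_pos
    rw [← hv] at hpos
    exact ae_of_ae_map (measurable_pi_apply v).aemeasurable hpos
  have hset : {e : List ℕ → ℝ | centredRightmost θ c n (x, e) ≤ y}
      =ᵐ[Measure.infinitePi fun _ : List ℕ => expMeasure 1]
      Set.pi (generation x n) fun v => Set.Ici (τ v) := by
    filter_upwards [hpos] with e he
    refine propext ?_
    change rightmost θ x e n - s / θ - 1 / θ * Real.log D ≤ y ↔
      ∀ v ∈ (generation x n : Set (List ℕ)), τ v ≤ e v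
    rw [rightmost, sub_le_iff_le_add, sub_le_iff_le_add, csSup_le_iff
      ((generation x n).finite_toSet.image _).bddAbove (Set.Nonempty.image _ hx),
      Set.forall_mem_image]
    refine forall₂_congr fun v _ => ?_
    have hlog : Real.log (τ v) = θ * position x v - s + (-(θ * y) - Real.log D) := by
      simp only [τ]
      rw [Real.log_mul (Real.exp_ne_zero _) (by positivity),
        Real.log_div (Real.exp_ne_zero _) hDpos.ne', Real.log_exp, Real.log_exp]
    rw [← Real.log_le_log_iff (hτ v) (he v), hlog]
    have h1 : y + 1 / θ * Real.log D + s / θ = (θ * y + Real.log D + s) / θ := by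
      field_simp
    have h2 : position x v + 1 / θ * -Real.log (e v)
        = (θ * position x v - Real.log (e v)) / θ := by
      field_simp
      ring
    rw [h1, h2, div_le_div_iff_of_pos_right hθ]
    constructor <;> intro h <;> linarith
  rw [measure_congr hset, Measure.infinitePi_pi _ fun _ _ => measurableSet_Ici]
  simp_rw [expMeasure_one_Ici (hτ _)]
  rw [← ENNReal.ofReal_prod_of_nonneg fun _ _ => (Real.exp_pos _).le, ← Real.exp_sum,
    Finset.sum_neg_distrib, ← Finset.sum_mul]
  change ENNReal.ofReal (Real.exp (-(D * (Real.exp (-(θ * y)) / D)))) = _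
  rw [mul_div_cancel₀ _ hDpos.ne']

theorem map_centredRightmost {θ : ℝ} (hθ : 0 < θ) (c : ℕ → ℝ) {n : ℕ} {μ : Measure Tree}
    [IsProbabilityMeasure μ] (hμ : ∀ᵐ x ∂μ, (generation x n).Nonempty) :
    (μ.prod (Measure.infinitePi fun _ : List ℕ => expMeasure 1)).map (centredRightmost θ c n)
      = (expMeasure 1).map (fun u => 1 / θ * (-Real.log u)) := by
  have := isProbabilityMeasure_expMeasure one_pos
  have hm := measurable_centredRightmost θ c n
  have := Measure.isProbabilityMeasure_map
    (μ := μ.prod (Measure.infinitePi fun _ : List ℕ => expMeasure 1)) hm.aemeasurable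
  refine Measure.ext_of_Iic _ _ fun y => ?_
  rw [map_log_exp_Iic hθ, Measure.map_apply hm measurableSet_Iic,
    Measure.prod_apply (hm measurableSet_Iic)]
  calc _ = ∫⁻ _, ENNReal.ofReal (Real.exp (-Real.exp (-(θ * y)))) ∂μ := by
        refine lintegral_congr_ae ?_
        filter_upwards [hμ] with x hx using measure_centredRightmost_le hθ c hx y
    _ = _ := by simp

/-! ### Analysis of the log-Laplace transform -/

section

variable {Z : Measure Offspring}

/-- The points of a configuration, with their marks, under the intensity measure. -/
noncomputable def campbell (Z : Measure Offspring) : Measure (Offspring × ℕ) :=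
  (Z.prod Measure.count).restrict {q | q.2 < q.1.1}

theorem measurable_point : Measurable fun q : Offspring × ℕ => q.1.2 q.2 :=
  measurable_comp_of_countable (F := fun j (q : Offspring × ℕ) => q.1.2 j) (fun j => by fun_prop)
    fun j => measurable_snd (measurableSet_singleton j)

theorem expSum_nonneg (a : ℝ) (x : Offspring) : 0 ≤ expSum a x :=
  Finset.sum_nonneg fun _ _ => (Real.exp_pos _).le

theorem lintegral_campbell (a : ℝ) :
    ∫⁻ q, ENNReal.ofReal (Real.exp (a * q.1.2 q.2)) ∂campbell Z
      = ∫⁻ x, ENNReal.ofReal (expSum a x) ∂Z := by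
  have hs : MeasurableSet {q : Offspring × ℕ | q.2 < q.1.1} :=
    measurableSet_lt measurable_snd measurable_fst.fst
  have hm : Measurable fun q : Offspring × ℕ => ENNReal.ofReal (Real.exp (a * q.1.2 q.2)) :=
    (Real.measurable_exp.comp (measurable_point.const_mul a)).ennreal_ofReal
  rw [campbell, ← lintegral_indicator hs, lintegral_prod _ (hm.indicator hs).aemeasurable]
  refine lintegral_congr fun x => ?_
  rw [lintegral_count, expSum, ENNReal.ofReal_sum_of_nonneg fun _ _ => (Real.exp_pos _).le,
    tsum_eq_sum (s := Finset.range x.1)]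
  · refine Finset.sum_congr rfl fun j hj => ?_
    rw [Set.indicator_of_mem]
    exact Finset.mem_range.1 hj
  · intro j hj
    rw [Set.indicator_of_notMem]
    exact fun h => hj (Finset.mem_range.2 h)

/-- As a cumulant generating function, `ν` is analytic in the interior of its domain; this includes
`0` since the domain extends below `0`. -/
theorem nu_eq_cgf : nu Z = cgf (fun q : Offspring × ℕ => q.1.2 q.2) (campbell Z) := by
  ext a
  have hm : Measurable fun q : Offspring × ℕ => Real.exp (a * q.1.2 q.2) :=
    Real.measurable_exp.comp (measurable_point.const_mul a)
  rw [nu, cgf, mgf, integral_eq_lintegral_of_nonneg_ae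
    (ae_of_all _ fun q => (Real.exp_pos _).le) hm.aestronglyMeasurable, lintegral_campbell,
    integral_eq_lintegral_of_nonneg_ae (ae_of_all _ fun x => expSum_nonneg a x)
    (measurable_expSum a).aestronglyMeasurable]

theorem integrable_campbell {a : ℝ} (ha : Integrable (expSum a) Z) :
    Integrable (fun q : Offspring × ℕ => Real.exp (a * q.1.2 q.2)) (campbell Z) := by
  refine ⟨(Real.measurable_exp.comp (measurable_point.const_mul a)).aestronglyMeasurable, ?_⟩
  rw [hasFiniteIntegral_iff_ofReal (ae_of_all _ fun q => (Real.exp_pos _).le), lintegral_campbell,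
    ← hasFiniteIntegral_iff_ofReal (ae_of_all _ fun x => expSum_nonneg a x)]
  exact ha.2

theorem Admissible.analyticAt_nu (hZ : Admissible Z) {a : ℝ} (ha : 0 ≤ a) :
    AnalyticAt ℝ (nu Z) a := by
  obtain ⟨ϑ, hϑ, hint⟩ := hZ.finite_nu
  rw [nu_eq_cgf]
  refine analyticAt_cgf ?_
  rw [mem_interior]
  exact ⟨Set.Ioi (-ϑ), fun b hb => integrable_campbell (hint b hb), isOpen_Ioi,
    by simp only [Set.mem_Ioi]; linarith⟩

theorem Admissible.integrable_expSum (hZ : Admissible Z) {a : ℝ} (ha : 0 ≤ a) :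
    Integrable (expSum a) Z := by
  obtain ⟨ϑ, hϑ, hint⟩ := hZ.finite_nu
  exact hint a (by linarith)

/-- Convexity bounds `(∑ exp (θ ξ_j)) ^ p` by `N ^ (p - 1) * ∑ exp (p θ ξ_j)`. Young's inequality
with exponent `r / (p - 1)` turns `N ^ (p - 1)` into `N ^ r`, and summing over `j` gives `N ^ (1 +
r)`. The conjugate exponent costs nothing, as all positive exponential moments are finite. -/
theorem Admissible.eventually_integrable_rpow (hZ : Admissible Z) {θ : ℝ} (hθ : 0 < θ) :
    ∀ᶠ p in 𝓝[>] (1 : ℝ), Integrable (fun x => expSum θ x ^ p) Z := by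
  obtain ⟨r, hr, hN⟩ := hZ.moment
  filter_upwards [self_mem_nhdsWithin, Ioo_mem_nhdsGT (show (1 : ℝ) < 1 + r by linarith)]
    with p hp hpr
  have hp1 : (0 : ℝ) < p - 1 := sub_pos.2 hp
  have hu1 : 1 < r / (p - 1) := by
    rw [one_lt_div hp1]; linarith [hpr.2]
  set u := r / (p - 1) with hu
  have hconj := Real.HolderConjugate.conjExponent hu1
  set w := u.conjExponent with hw
  have hb : Integrable (expSum (p * w * θ)) Z := hZ.integrable_expSum
    (mul_nonneg (mul_nonneg (by linarith) hconj.symm.nonneg) hθ.le)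
  refine (hN.add hb).mono' ((measurable_expSum θ).pow_const p).aestronglyMeasurable
    (ae_of_all _ fun x => ?_)
  rw [Real.norm_of_nonneg (Real.rpow_nonneg (expSum_nonneg θ x) p)]
  have h1 := Real.rpow_sum_le_const_mul_sum_rpow_of_nonneg (Finset.range x.1)
    (f := fun j => Real.exp (θ * x.2 j)) hp.le fun _ _ => (Real.exp_pos _).le
  refine h1.trans ?_
  rw [Finset.card_range, Finset.mul_sum, Pi.add_apply, expSum]
  have hN0 : (0 : ℝ) ≤ x.1 := Nat.cast_nonneg _
  have h2 : ∀ j ∈ Finset.range x.1, (x.1 : ℝ) ^ (p - 1) * Real.exp (θ * x.2 j) ^ p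
      ≤ (x.1 : ℝ) ^ r + Real.exp (p * w * θ * x.2 j) := by
    intro j _
    refine (Real.young_inequality_of_nonneg (Real.rpow_nonneg hN0 _)
      (Real.rpow_nonneg (Real.exp_pos _).le _) hconj).trans (add_le_add ?_ ?_)
    · refine (div_le_self (Real.rpow_nonneg (Real.rpow_nonneg hN0 _) _) hu1.le).trans (le_of_eq ?_)
      rw [← Real.rpow_mul hN0, hu, mul_div_cancel₀ _ hp1.ne']
    · refine (div_le_self (Real.rpow_nonneg (Real.rpow_nonneg (Real.exp_pos _).le _) _)
        hconj.symm.lt.le).trans (le_of_eq ?_)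
      rw [← Real.exp_mul, ← Real.exp_mul]
      ring_nf
  refine (Finset.sum_le_sum h2).trans (le_of_eq ?_)
  rw [Finset.sum_add_distrib, Finset.sum_const, Finset.card_range, nsmul_eq_mul]
  congr 1
  rcases hN0.eq_or_lt with h0 | h0
  · rw [← h0, zero_mul, Real.zero_rpow (by linarith)]
  · rw [Real.rpow_add h0, Real.rpow_one]

theorem normOffspring_eq (a c : ℝ) (x : Offspring) :
    normOffspring a c x = Real.exp (-c) * expSum a x := by
  rw [normOffspring, expSum, Finset.mul_sum]
  refine Finset.sum_congr rfl fun j _ => ?_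
  rw [← Real.exp_add]
  ring_nf

theorem MomentBounds.mono {θ p s s' C C' : ℝ} (h : MomentBounds θ p s C Z) (hs0 : 0 ≤ s)
    (hs : s ≤ s') (hC : C ≤ C') : MomentBounds θ p s' C' Z where
  integrable := h.integrable
  mean := h.mean
  contraction := h.contraction.trans (ENNReal.ofReal_le_ofReal (pow_le_pow_left₀ hs0 hs 2))
  integrable_rpow := h.integrable_rpow
  moment := h.moment.trans hC

variable [IsProbabilityMeasure Z]

theorem Admissible.exp_nu (hZ : Admissible Z) {a : ℝ} (ha : 0 ≤ a) :
    Real.exp (nu Z a) = ∫ x, expSum a x ∂Z := by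
  rw [nu, Real.exp_log]
  rw [integral_pos_iff_support_of_nonneg (expSum_nonneg a) (hZ.integrable_expSum ha)]
  have h1 : ∀ᵐ x ∂Z, x ∈ Function.support (expSum a) := by
    filter_upwards [hZ.no_extinction] with x hx
    exact (Finset.sum_pos (fun _ _ => Real.exp_pos _)
      (Finset.nonempty_range_iff.2 (by omega))).ne'
  have h2 : Z (Function.support (expSum a)) = 1 :=
    (measure_congr (eventuallyEq_univ.2 h1)).trans measure_univ
  rw [h2]
  exact one_pos

theorem Admissible.nu_zero_pos (hZ : Admissible Z) : 0 < nu Z 0 := by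
  refine Real.log_pos ?_
  have h0 : ∀ x, expSum 0 x = x.1 := fun x => by simp [expSum]
  have hint := hZ.integrable_expSum le_rfl
  have hint1 : Integrable (fun x => expSum 0 x - 1) Z := hint.sub (integrable_const 1)
  have hpos : 0 < ∫ x, (expSum 0 x - 1) ∂Z := by
    rw [integral_pos_iff_support_of_nonneg_ae ?_ hint1]
    · have hs : Function.support (fun x : Offspring => expSum 0 x - 1) = {x | x.1 = 1}ᶜ := by
        ext x
        simp [h0, sub_eq_zero]
      rw [hs, pos_iff_ne_zero]
      intro h
      exact hZ.number_nontrivial.ne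
        ((prob_compl_eq_zero_iff (measurable_fst (measurableSet_singleton 1))).1 h)
    · filter_upwards [hZ.no_extinction] with x hx
      rw [h0]
      simpa using hx
  rw [integral_sub hint (integrable_const 1)] at hpos
  simpa using hpos

/-- The function `a ν'(a) - ν(a)` equals `-ν(0) < 0` at `0`. Were it nonnegative at `θ`, the
intermediate value theorem would give a zero in `(0, θ]`, against the definition of the critical
value. -/
theorem Admissible.mul_deriv_nu_lt (hZ : Admissible Z) {θ : ℝ} (hθ : 0 < θ)
    (hcrit : (θ : EReal) < thetaCrit Z) : θ * deriv (nu Z) θ < nu Z θ := by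
  by_contra! hcon
  have hcont : ContinuousOn (fun a => a * deriv (nu Z) a - nu Z a) (Set.Icc 0 θ) := by
    intro a ha
    have hA := hZ.analyticAt_nu ha.1
    exact ((continuousAt_id.mul hA.deriv.continuousAt).sub hA.continuousAt).continuousWithinAt
  obtain ⟨a, ha, ha0⟩ := intermediate_value_Icc hθ.le hcont
    (show (0 : ℝ) ∈ Set.Icc _ _ from ⟨by simpa using hZ.nu_zero_pos.le, by linarith⟩)
  have ha_pos : 0 < a := by
    refine ha.1.lt_of_ne fun h => ?_
    rw [← h] at ha0
    have := hZ.nu_zero_pos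
    simp at ha0
    linarith
  have hmem : (a : EReal) ∈ (fun a : ℝ => (a : EReal)) ''
      {a : ℝ | 0 < a ∧ nu Z a / a = deriv (nu Z) a} := by
    refine ⟨a, ⟨ha_pos, ?_⟩, rfl⟩
    rw [div_eq_iff ha_pos.ne']
    simp only at ha0
    linarith
  exact absurd (hcrit.trans_le (sInf_le hmem)) (not_lt.2 (EReal.coe_le_coe_iff.2 ha.2))

/-- At `p = 1` the difference of the two sides vanishes and has derivative `θ ν'(θ) - ν(θ) < 0`. -/
theorem Admissible.eventually_nu_mul_lt (hZ : Admissible Z) {θ : ℝ} (hθ : 0 < θ)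
    (hcrit : (θ : EReal) < thetaCrit Z) : ∀ᶠ p in 𝓝[>] (1 : ℝ), nu Z (p * θ) < p * nu Z θ := by
  have hd : HasDerivAt (fun p => nu Z (p * θ) - p * nu Z θ) (deriv (nu Z) θ * θ - nu Z θ) 1 := by
    have h1 : HasDerivAt (nu Z) (deriv (nu Z) θ) (1 * θ) := by
      rw [one_mul]
      exact (hZ.analyticAt_nu hθ.le).differentiableAt.hasDerivAt
    have h2 : HasDerivAt (fun p : ℝ => p * θ) θ 1 := by
      simpa using (hasDerivAt_id (1 : ℝ)).mul_const θ
    have h3 : HasDerivAt (fun p : ℝ => p * nu Z θ) (nu Z θ) 1 := by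
      simpa using (hasDerivAt_id (1 : ℝ)).mul_const (nu Z θ)
    exact (HasDerivAt.comp (1 : ℝ) h1 h2).sub h3
  have hneg : deriv (nu Z) θ * θ - nu Z θ < 0 := by
    linarith [hZ.mul_deriv_nu_lt hθ hcrit]
  have hslope := (hasDerivAt_iff_tendsto_slope.1 hd).mono_left
    (nhdsWithin_mono 1 fun p (hp : 1 < p) => hp.ne')
  filter_upwards [hslope.eventually_lt_const hneg, self_mem_nhdsWithin] with p hp hp1
  rw [slope_def_field] at hp
  have hp1' : (0 : ℝ) < p - 1 := sub_pos.2 hp1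
  have := (div_lt_iff₀ hp1').1 hp
  simp only [one_mul, sub_self, sub_zero, zero_mul] at this
  linarith

theorem Admissible.eventually_momentBounds (hZ : Admissible Z) {θ : ℝ} (hθ : 0 < θ)
    (hcrit : (θ : EReal) < thetaCrit Z) :
    ∀ᶠ p in 𝓝[>] (1 : ℝ), ∃ s C, 0 < s ∧ s < 1 ∧ 0 ≤ C ∧ MomentBounds θ p s C Z := by
  filter_upwards [hZ.eventually_nu_mul_lt hθ hcrit, hZ.eventually_integrable_rpow hθ,
    self_mem_nhdsWithin] with p hlt hint (hp : 1 < p)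
  have hp0 : 0 < p := by linarith
  have hW : normOffspring θ (nu Z θ) = fun x => Real.exp (-nu Z θ) * expSum θ x :=
    funext fun x => normOffspring_eq _ _ x
  have hWp : Integrable (fun x => normOffspring θ (nu Z θ) x ^ p) Z := by
    simp_rw [normOffspring_eq, Real.mul_rpow (Real.exp_pos _).le (expSum_nonneg _ _)]
    exact hint.const_mul _
  -- Halving the exponent makes `s ^ 2` exactly the mean of the `p`-th power weights; `C` is the
  -- moment itself.
  refine ⟨Real.exp ((nu Z (p * θ) - p * nu Z θ) / 2),
    ∫ y, |normOffspring θ (nu Z θ) y - 1| ^ p ∂Z, Real.exp_pos _, ?_, ?_, ?_, ?_, ?_, ?_, le_rfl⟩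
  · rw [Real.exp_lt_one_iff]; linarith
  · exact integral_nonneg fun x => Real.rpow_nonneg (abs_nonneg _) _
  · rw [hW]
    exact (hZ.integrable_expSum hθ.le).const_mul _
  · rw [hW, integral_const_mul, ← hZ.exp_nu hθ.le, ← Real.exp_add]
    simp
  · have h1 : Integrable (normOffspring (p * θ) (p * nu Z θ)) Z := by
      rw [show normOffspring (p * θ) (p * nu Z θ) = fun x => _ from
        funext fun x => normOffspring_eq _ _ x]
      exact (hZ.integrable_expSum (by positivity)).const_mul _
    rw [← ofReal_integral_eq_lintegral_ofReal h1
      (ae_of_all _ fun x => normOffspring_nonneg _ _ x)]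
    refine ENNReal.ofReal_le_ofReal (le_of_eq ?_)
    simp_rw [normOffspring_eq]
    rw [integral_const_mul, ← hZ.exp_nu (by positivity), ← Real.exp_add, ← Real.exp_nat_mul]
    push_cast
    ring_nf
  · refine (hWp.add (integrable_const 1)).mono' ?_ (ae_of_all _ fun x => ?_)
    · exact (((measurable_normOffspring _ _).sub_const 1).abs.pow_const p).aestronglyMeasurable
    · have h0 := normOffspring_nonneg θ (nu Z θ) x
      rw [Real.norm_of_nonneg (Real.rpow_nonneg (abs_nonneg _) _), Pi.add_apply]
      rcases le_total (normOffspring θ (nu Z θ) x) 1 with h | h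
      · refine (Real.rpow_le_one (abs_nonneg _) ?_ hp0.le).trans
          (le_add_of_nonneg_left (Real.rpow_nonneg h0 _))
        rw [abs_le]
        constructor <;> linarith
      · refine (Real.rpow_le_rpow (abs_nonneg _) ?_ hp0.le).trans
          (le_add_of_nonneg_right zero_le_one)
        rw [abs_of_nonneg (by linarith)]
        linarith

end

/-- Each law allows every `p` close enough to `1`, so finitely many laws share one; `s` and `C` can
then be enlarged. -/
theorem exists_uniform_momentBounds {ι : Type*} [Finite ι] {Z : ι → Measure Offspring}
    [∀ i, IsProbabilityMeasure (Z i)] (hZ : ∀ i, Admissible (Z i)) {θ : ℝ} (hθ : 0 < θ)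
    (hcrit : ∀ i, (θ : EReal) < thetaCrit (Z i)) :
    ∃ p s C : ℝ, 1 < p ∧ p ≤ 2 ∧ 0 < s ∧ s < 1 ∧ 0 ≤ C ∧ ∀ i, MomentBounds θ p s C (Z i) := by
  have hev : ∀ᶠ p in 𝓝[>] (1 : ℝ), (∀ i, ∃ s C, 0 < s ∧ s < 1 ∧ 0 ≤ C ∧
      MomentBounds θ p s C (Z i)) ∧ 1 < p ∧ p ≤ 2 := by
    filter_upwards [eventually_all.2 fun i => (hZ i).eventually_momentBounds hθ (hcrit i),
      self_mem_nhdsWithin, Ioc_mem_nhdsGT (show (1 : ℝ) < 2 by norm_num)] with p h h1 h2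
    exact ⟨h, h1, h2.2⟩
  obtain ⟨p, hp, hp1, hp2⟩ := hev.exists
  choose s C hs0 hs1 hC hB using hp
  have hs' : ∀ᶠ t in 𝓝[<] (1 : ℝ), ∀ i, s i ≤ t :=
    eventually_all.2 fun i => by
      filter_upwards [Ioo_mem_nhdsLT (hs1 i)] with t ht using ht.1.le
  have hC' : ∀ᶠ t : ℝ in atTop, ∀ i, C i ≤ t := eventually_all.2 fun i => eventually_ge_atTop _
  obtain ⟨t, ⟨ht, ht1⟩, ht0⟩ := ((hs'.and self_mem_nhdsWithin).and
    (Ioo_mem_nhdsLT (show (0 : ℝ) < 1 by norm_num))).exists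
  obtain ⟨B, hB1, hB0⟩ := (hC'.and (eventually_ge_atTop 0)).exists
  exact ⟨p, t, B, hp1, hp2, ht0.1, ht1, hB0, fun i => (hB i).mono (hs0 i).le (ht i) (hB1 i)⟩

/-! ### Macroscopic time steps -/

theorem sum_Iic_eq_sum_Iio_add {k : ℕ} (q : Fin k → ℕ) (i : Fin k) :
    ∑ j ∈ Finset.Iic i, q j = ∑ j ∈ Finset.Iio i, q j + q i := by
  rw [Finset.Iic_eq_cons_Iio, Finset.sum_cons, add_comm]

/-- The times at which the particles reproduce according to the `i`-th law. -/
def timeStep {k : ℕ} (q : Fin k → ℕ) (i : Fin k) : Finset ℕ :=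
  Finset.Ico (∑ j ∈ Finset.Iio i, q j) (∑ j ∈ Finset.Iic i, q j)

theorem pairwiseDisjoint_timeStep {k : ℕ} (q : Fin k → ℕ) :
    Set.PairwiseDisjoint (Set.univ : Set (Fin k)) (timeStep q) := by
  have key : ∀ i j : Fin k, i < j → Disjoint (timeStep q i) (timeStep q j) := by
    intro i j hij
    refine Finset.disjoint_left.2 fun t hi hj => ?_
    have h1 := (Finset.mem_Ico.1 hi).2
    have h2 := (Finset.mem_Ico.1 hj).1
    have h3 : ∑ l ∈ Finset.Iic i, q l ≤ ∑ l ∈ Finset.Iio j, q l :=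
      Finset.sum_le_sum_of_subset fun l hl =>
        Finset.mem_Iio.2 ((Finset.mem_Iic.1 hl).trans_lt hij)
    omega
  intro i _ j _ hij
  rcases lt_or_gt_of_ne hij with h | h
  exacts [key i j h, (key j i h).symm]

theorem biUnion_timeStep {k : ℕ} (q : Fin k → ℕ) :
    Finset.univ.biUnion (timeStep q) = Finset.range (∑ i, q i) := by
  refine Finset.eq_of_subset_of_card_le (fun t ht => ?_) ?_
  · obtain ⟨i, -, hi⟩ := Finset.mem_biUnion.1 ht
    exact Finset.mem_range.2 ((Finset.mem_Ico.1 hi).2.trans_le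
      (Finset.sum_le_sum_of_subset (Finset.subset_univ _)))
  · rw [Finset.card_biUnion fun i _ j _ hij =>
      pairwiseDisjoint_timeStep q (Set.mem_univ i) (Set.mem_univ j) hij]
    simp [timeStep, sum_Iic_eq_sum_Iio_add]

theorem mem_timeStep_zero {k : ℕ} [NeZero k] (q : Fin k → ℕ) {t : ℕ} (ht : t < q 0) :
    t ∈ timeStep q 0 := by
  have h0 : Finset.Iio (0 : Fin k) = ∅ := by
    ext i; simp
  rw [timeStep, sum_Iic_eq_sum_Iio_add, h0]
  simpa using ht

open Classical in
/-- The reproduction law of the particles of generation `t`. -/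
noncomputable def stepLaw {k : ℕ} (Z : Fin k → Measure Offspring) (q : Fin k → ℕ) (t : ℕ) :
    Measure Offspring :=
  -- Past the last time step `default` has no children; this value only has to be a probability
  -- measure.
  if h : ∃ i, t ∈ timeStep q i then Z h.choose else Measure.dirac default

section

variable {k : ℕ} (Z : Fin k → Measure Offspring) (q : Fin k → ℕ)

theorem stepLaw_of_mem {t : ℕ} {i : Fin k} (h : t ∈ timeStep q i) : stepLaw Z q t = Z i := by
  have hex : ∃ i, t ∈ timeStep q i := ⟨i, h⟩
  rw [stepLaw, dif_pos hex]
  by_contra hne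
  have hij : hex.choose ≠ i := fun h' => hne (by rw [h'])
  exact Finset.disjoint_left.1 (pairwiseDisjoint_timeStep q (Set.mem_univ _) (Set.mem_univ _) hij)
    hex.choose_spec h

theorem exists_mem_timeStep {t : ℕ} (ht : t < ∑ i, q i) : ∃ i, t ∈ timeStep q i := by
  have := Finset.mem_range.2 ht
  rw [← biUnion_timeStep] at this
  simpa using this

theorem stepLaw_of_le {t : ℕ} (ht : ∑ i, q i ≤ t) : stepLaw Z q t = Measure.dirac default := by
  rw [stepLaw, dif_neg]
  rintro ⟨i, hi⟩
  have : t ∈ Finset.univ.biUnion (timeStep q) := Finset.mem_biUnion.2 ⟨i, Finset.mem_univ i, hi⟩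
  rw [biUnion_timeStep] at this
  exact absurd (Finset.mem_range.1 this) (not_lt.2 ht)

instance [∀ i, IsProbabilityMeasure (Z i)] (t : ℕ) : IsProbabilityMeasure (stepLaw Z q t) := by
  unfold stepLaw
  split_ifs <;> infer_instance

theorem sum_nu_stepLaw (θ : ℝ) :
    ∑ t ∈ Finset.range (∑ i, q i), nu (stepLaw Z q t) θ = ∑ i, q i * nu (Z i) θ := by
  rw [← biUnion_timeStep, Finset.sum_biUnion fun i _ j _ hij =>
    pairwiseDisjoint_timeStep q (Set.mem_univ i) (Set.mem_univ j) hij]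
  refine Finset.sum_congr rfl fun i _ => ?_
  rw [Finset.sum_congr rfl fun t ht => by rw [stepLaw_of_mem Z q ht], Finset.sum_const,
    nsmul_eq_mul]
  congr 1
  simp [timeStep, sum_Iic_eq_sum_Iio_add]

end

/-! ### The walk stopped at a generation -/

/-- The tree `x` with the reproduction of generation `n` and of the later ones forgotten. -/
def truncateTree (n : ℕ) (x : Tree) : Tree := fun v => if v.length < n then x v else default

theorem truncateTree_apply {n : ℕ} {x : Tree} {v : List ℕ} (hv : v.length < n) :
    truncateTree n x v = x v := by
  simp [truncateTree, hv]

theorem measurable_truncateTree (n : ℕ) : Measurable (truncateTree n) := by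
  refine measurable_pi_lambda _ fun v => ?_
  unfold truncateTree
  split_ifs
  exacts [measurable_tree_apply v, measurable_const]

theorem rightmost_truncateTree (θ : ℝ) (x : Tree) (e : List ℕ → ℝ) (n : ℕ) :
    rightmost θ (truncateTree n x) e n = rightmost θ x e n := by
  unfold rightmost
  rw [generation_congr fun v hv => truncateTree_apply (x := x) hv]
  congr 1
  refine Set.image_congr fun v hv => ?_
  rw [position_congr fun w hw => truncateTree_apply (x := x)
    (by rwa [length_of_mem_generation hv] at hw)]

/-- Nothing is known of the laws of `X v` beyond the last time step. Truncation replaces them by a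
constant, which pins down the law of the whole tree and leaves `rightmost` unchanged. -/
theorem IsModifiedBRW.hasLaw {Ω : Type*} [MeasurableSpace Ω] {P : Measure Ω}
    [IsProbabilityMeasure P] {k : ℕ} {Z : Fin k → Measure Offspring}
    [∀ i, IsProbabilityMeasure (Z i)] {q : Fin k → ℕ} {X : List ℕ → Ω → Offspring}
    {E : List ℕ → Ω → ℝ} (h : IsModifiedBRW P Z q X E) :
    HasLaw (fun ω => (truncateTree (∑ i, q i) (fun v => X v ω), fun v => E v ω))
      ((treeLaw (stepLaw Z q)).prod (Measure.infinitePi fun _ : List ℕ => expMeasure 1)) P := by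
  set n := ∑ i, q i with hn
  let g : List ℕ → Offspring → Offspring := fun v y => if v.length < n then y else default
  have hg : ∀ v, Measurable (g v) := fun v => by
    by_cases hv : v.length < n
    · simp only [g, hv, if_true]
      exact measurable_id
    · simp [g, hv]
  have hX : ∀ v, HasLaw (g v ∘ X v) (stepLaw Z q v.length) P := by
    intro v
    by_cases hv : v.length < n
    · obtain ⟨i, hi⟩ := exists_mem_timeStep q hv
      rw [stepLaw_of_mem Z q hi]
      have hgv : g v ∘ X v = X v := by ext1 ω; simp [g, hv]
      rw [hgv]
      have := Finset.mem_Ico.1 hi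
      exact h.law i v (by omega) (by omega)
    · rw [stepLaw_of_le Z q (not_lt.1 hv)]
      have hgv : g v ∘ X v = fun _ => default := by ext1 ω; simp [g, hv]
      rw [hgv]
      exact ⟨aemeasurable_const, by simp [Measure.map_const]⟩
  have hT : HasLaw (fun ω => truncateTree n (fun v => X v ω)) (treeLaw (stepLaw Z q)) P :=
    (h.indep.comp g hg).hasLaw_infinitePi hX
      (aemeasurable_pi_iff.2 fun v => (hX v).aemeasurable)
  have hE : HasLaw (fun ω v => E v ω) (Measure.infinitePi fun _ : List ℕ => expMeasure 1) P :=
    h.indep_exp.hasLaw_infinitePi h.law_exp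
      (aemeasurable_pi_iff.2 fun v => (h.law_exp v).aemeasurable)
  have hind : IndepFun (fun ω => truncateTree n (fun v => X v ω)) (fun ω v => E v ω) P :=
    h.indep_tree_exp.comp (measurable_truncateTree n) measurable_id
  refine ⟨hT.aemeasurable.prodMk hE.aemeasurable, ?_⟩
  rw [(indepFun_iff_map_prod_eq_prod_map_map hT.aemeasurable hE.aemeasurable).1 hind, hT.map_eq,
    hE.map_eq]

theorem ae_generation_nonempty {ζ : ℕ → Measure Offspring} [∀ t, IsProbabilityMeasure (ζ t)]
    {n : ℕ} (h : ∀ t < n, ∀ᵐ y ∂ζ t, 1 ≤ y.1) :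
    ∀ᵐ x ∂treeLaw ζ, (generation x n).Nonempty := by
  have : ∀ᵐ x ∂treeLaw ζ, ∀ v : List ℕ, v.length < n → 1 ≤ (x v).1 := by
    rw [ae_all_iff]
    intro v
    by_cases hv : v.length < n
    · filter_upwards [(measurePreserving_treeLaw_apply ζ v).quasiMeasurePreserving.ae
        (h _ hv)] with x hx _ using hx
    · exact ae_of_all _ fun x hx => absurd hx hv
  filter_upwards [this] with x hx using generation_nonempty hx

/-! ### Convergence in measure under a change of variables -/

/-- Subsequence principle: only continuity at almost every value of the limit is needed, which suits
the logarithm at an almost surely positive `D`. -/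
theorem tendstoInMeasure_comp_of_continuousAt {α : Type*} [MeasurableSpace α] {μ : Measure α}
    [IsFiniteMeasure μ] {f : ℕ → α → ℝ} {g : α → ℝ} {φ : ℝ → ℝ} (hφ : Measurable φ)
    (hf : ∀ n, AEMeasurable (f n) μ) (hfg : TendstoInMeasure μ f atTop g)
    (hg : ∀ᵐ x ∂μ, ContinuousAt φ (g x)) :
    TendstoInMeasure μ (fun n x => φ (f n x)) atTop (fun x => φ (g x)) := by
  have hφf : ∀ n, AEStronglyMeasurable (fun x => φ (f n x)) μ := fun n =>
    (hφ.comp_aemeasurable (hf n)).aestronglyMeasurable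
  rw [exists_seq_tendstoInMeasure_atTop_iff hφf]
  intro ns hns
  obtain ⟨ns', hns', hlim⟩ := (exists_seq_tendstoInMeasure_atTop_iff
    fun n => (hf n).aestronglyMeasurable).1 hfg ns hns
  refine ⟨ns', hns', ?_⟩
  filter_upwards [hlim, hg] with x hx hgx using hgx.tendsto.comp hx

/-- Both quantities are compared with the common normalised sum at generation `m`; the two geometric
tails account for the factor `2`. -/
theorem lintegral_normSum_sub_martingaleLimit_le {Ω : Type*} [MeasurableSpace Ω] {P : Measure Ω}
    [IsProbabilityMeasure P] {Z : Measure Offspring} [IsProbabilityMeasure Z]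
    {ζ : ℕ → Measure Offspring} [∀ t, IsProbabilityMeasure (ζ t)] {θ p s C : ℝ} (hp1 : 1 ≤ p)
    (hp2 : p ≤ 2) (hs0 : 0 < s) (hs1 : s < 1) (hC : 0 ≤ C) {m n : ℕ} (hmn : m ≤ n)
    (hZ : MomentBounds θ p s C Z) (hζ : ∀ t < n, MomentBounds θ p s C (ζ t))
    (hζZ : ∀ t < m, ζ t = Z) {T Y : Ω → Tree} (hT : HasLaw T (treeLaw ζ) P)
    (hY : HasLaw Y (treeLaw fun _ => Z) P)
    (hTY : ∀ᵐ ω ∂P, ∀ v : List ℕ, v.length < m → T ω v = Y ω v) :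
    ∫⁻ ω, ‖normSum θ (fun t => nu (ζ t) θ) (T ω) n - martingaleLimit Z θ (Y ω)‖ₑ ∂P
      ≤ ENNReal.ofReal (2 * ((1 + 3 * C) / (1 - s)) * s ^ m) := by
  set c : ℕ → ℝ := fun t => nu (ζ t) θ
  have h1s : 0 < 1 - s := by linarith
  have h1 : ∫⁻ ω, ‖normSum θ c (T ω) n - normSum θ c (T ω) m‖ₑ ∂P
      ≤ ENNReal.ofReal ((1 + 3 * C) / (1 - s) * s ^ m) := by
    have hm : Measurable fun x : Tree => ‖normSum θ c x n - normSum θ c x m‖ₑ := by fun_prop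
    have := lintegral_map' hm.aemeasurable hT.aemeasurable
    rw [hT.map_eq] at this
    rw [← this]
    exact lintegral_sub_le_of_geometric_of_le (fun j => measurable_normSum θ c j) (by positivity)
      hs0.le hs1 (fun j hj => lintegral_normSum_succ_sub_le ζ hp1 hp2 hs0 hs1.le hC
        fun t ht => hζ t (ht.trans_lt hj)) hmn
  have h2 : ∫⁻ ω, ‖martingaleLimit Z θ (Y ω) - additiveMartingale Z θ (Y ω) m‖ₑ ∂P
      ≤ ENNReal.ofReal ((1 + 3 * C) / (1 - s) * s ^ m) := by
    have hm : Measurable fun x : Tree => ‖martingaleLimit Z θ x - additiveMartingale Z θ x m‖ₑ :=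
      ((measurable_martingaleLimit Z θ).sub (measurable_additiveMartingale Z θ m)).enorm
    have := lintegral_map' hm.aemeasurable hY.aemeasurable
    rw [hY.map_eq] at this
    rw [← this]
    exact lintegral_martingaleLimit_sub_le hp1 hp2 hs0 hs1 hC hZ m
  have hm1 : AEMeasurable (fun ω => ‖normSum θ c (T ω) n - normSum θ c (T ω) m‖ₑ) P :=
    (show Measurable fun x : Tree => ‖normSum θ c x n - normSum θ c x m‖ₑ by
      fun_prop).comp_aemeasurable hT.aemeasurable
  calc _ ≤ ∫⁻ ω, (‖normSum θ c (T ω) n - normSum θ c (T ω) m‖ₑ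
          + ‖martingaleLimit Z θ (Y ω) - additiveMartingale Z θ (Y ω) m‖ₑ) ∂P := by
        refine lintegral_mono_ae ?_
        filter_upwards [hTY] with ω hω
        have heq : normSum θ c (T ω) m = additiveMartingale Z θ (Y ω) m := by
          rw [normSum_congr hω, ← normSum_const]
          unfold normSum
          rw [Finset.sum_congr (s₁ := Finset.range m) rfl fun t ht =>
            show c t = nu Z θ by simp only [c]; rw [hζZ t (Finset.mem_range.1 ht)]]
        rw [heq]
        have := edist_triangle_right (normSum θ c (T ω) n) (martingaleLimit Z θ (Y ω))
          (additiveMartingale Z θ (Y ω) m)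
        simpa only [edist_eq_enorm_sub] using this
    _ ≤ _ := by
        rw [lintegral_add_left' hm1]
        refine (add_le_add h1 h2).trans (le_of_eq ?_)
        rw [← ENNReal.ofReal_add (by positivity) (by positivity)]
        ring_nf

end TIBRW

/-! ### The main theorem. -/

theorem mainTheorem1 {Ω : Type*} [MeasurableSpace Ω] (P : Measure Ω) [IsProbabilityMeasure P]
    (k : ℕ) [NeZero k]
    (Z : Fin k → Measure TIBRW.Offspring) [∀ i, IsProbabilityMeasure (Z i)]
    (hZ : ∀ i, TIBRW.Admissible (Z i))
    (q : Fin k → ℕ → ℕ) (hq_sum : ∀ n, ∑ i, q i n = n) (hq : ∀ i, Tendsto (q i) atTop atTop)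
    (θ : ℝ) (hθ_pos : 0 < θ) (hθ : (θ : EReal) < ⨅ i, TIBRW.thetaCrit (Z i))
    -- the process for each `n`, with its modification of the last generation
    (X : ℕ → List ℕ → Ω → TIBRW.Offspring) (E : ℕ → List ℕ → Ω → ℝ)
    (hX : ∀ n, TIBRW.IsModifiedBRW P Z (fun i => q i n) (X n) (E n))
    -- the homogeneous process driven by the first point process, whose first `q 0 n` generations
    -- are those of the `n`-th process
    (Y : List ℕ → Ω → TIBRW.Offspring)
    (hY_law : ∀ v, HasLaw (Y v) (Z 0) P) (hY_indep : iIndepFun Y P)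
    (hXY : ∀ n v, v.length < q 0 n → X n v =ᵐ[P] Y v)
    -- the limit variable
    {Ω' : Type*} [MeasurableSpace Ω'] (P' : Measure Ω') [IsProbabilityMeasure P']
    (E' : Ω' → ℝ) (hE' : HasLaw E' (expMeasure 1) P') :
    let D : Ω → ℝ := fun ω => TIBRW.martingaleLimit (Z 0) θ (fun v => Y v ω)
    (∀ᵐ ω ∂P, Tendsto (TIBRW.additiveMartingale (Z 0) θ (fun v => Y v ω)) atTop (𝓝 (D ω))) ∧
    (∀ᵐ ω ∂P, 0 < D ω) ∧
    TIBRW.IsMeanOneSolution (Z 0) θ (P.map D) ∧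
    (∀ ρ : Measure ℝ, TIBRW.IsMeanOneSolution (Z 0) θ ρ → ρ = P.map D) ∧
    TendstoInDistribution
      (fun (n : ℕ) ω =>
        TIBRW.rightmost θ (fun v => X n v ω) (fun v => E n v ω) n
          - ∑ i, (q i n : ℝ) * TIBRW.nu (Z i) θ / θ
          - 1 / θ * Real.log (D ω))
      atTop (fun ω' => 1 / θ * (-Real.log (E' ω'))) (fun _ => P) P' := by
  open TIBRW in
  intro D
  have hcrit : ∀ i, (θ : EReal) < thetaCrit (Z i) := fun i => hθ.trans_le (iInf_le _ i)
  obtain ⟨p, s, C, hp1, hp2, hs0, hs1, hC, hB⟩ := exists_uniform_momentBounds hZ hθ_pos hcrit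
  have hYtree : HasLaw (fun ω v => Y v ω) (treeLaw fun _ => Z 0) P :=
    hY_indep.hasLaw_infinitePi hY_law (aemeasurable_pi_iff.2 fun v => (hY_law v).aemeasurable)
  have htransfer : ∀ {r : Tree → Prop}, (∀ᵐ x ∂treeLaw (fun _ => Z 0), r x) →
      ∀ᵐ ω ∂P, r (fun v => Y v ω) := by
    intro r hr
    rw [← hYtree.map_eq] at hr
    exact ae_of_ae_map hYtree.aemeasurable hr
  have hmapD : P.map D = (treeLaw fun _ => Z 0).map (martingaleLimit (Z 0) θ) := by
    rw [← hYtree.map_eq, AEMeasurable.map_map_of_aemeasurable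
      (measurable_martingaleLimit (Z 0) θ).aemeasurable hYtree.aemeasurable]
    rfl
  have hDm : AEMeasurable D P :=
    (measurable_martingaleLimit (Z 0) θ).comp_aemeasurable hYtree.aemeasurable
  have hsol : IsMeanOneSolution (Z 0) θ (P.map D) := by
    rw [hmapD]
    exact isMeanOneSolution_map_martingaleLimit hp1.le hp2 hs0 hs1 hC (hB 0)
  have hDnn : ∀ᵐ ω ∂P, 0 ≤ D ω :=
    htransfer (ae_martingaleLimit_nonneg hp1.le hp2 hs0 hs1 hC (hB 0))
  have hDpos : ∀ᵐ ω ∂P, 0 < D ω := by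
    have h0 := hsol.measure_singleton_zero (hZ 0) ((ae_map_iff hDm measurableSet_Ici).2 hDnn)
    rw [Measure.map_apply_of_aemeasurable hDm (measurableSet_singleton 0)] at h0
    have h0' : ∀ᵐ ω ∂P, ¬ D ω = 0 := by
      rw [ae_iff]
      simp only [not_not]
      exact h0
    filter_upwards [hDnn, h0'] with ω h1 h2 using lt_of_le_of_ne h1 (Ne.symm h2)
  refine ⟨htransfer (ae_tendsto_martingaleLimit hp1.le hp2 hs0 hs1 hC (hB 0)), hDpos, hsol,
    fun ρ hρ => hρ.eq hp1 hs0 hs1 (hB 0) hsol, ?_⟩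
  let ζ : ℕ → ℕ → Measure Offspring := fun n => stepLaw Z fun i => q i n
  let c : ℕ → ℕ → ℝ := fun n t => nu (ζ n t) θ
  let T : ℕ → Ω → Tree := fun n ω => truncateTree n fun v => X n v ω
  let G : ℕ → Ω → ℝ := fun n ω => centredRightmost θ (c n) n (T n ω, fun v => E n v ω)
  have hlaw : ∀ n, HasLaw (fun ω => (T n ω, fun v => E n v ω))
      ((treeLaw (ζ n)).prod (Measure.infinitePi fun _ : List ℕ => expMeasure 1)) P := by
    intro n
    have := (hX n).hasLaw
    simp only [hq_sum] at this
    exact this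
  have := isProbabilityMeasure_expMeasure one_pos
  have hT : ∀ n, HasLaw (T n) (treeLaw (ζ n)) P := fun n =>
    (measurePreserving_fst.hasLaw).fun_comp (hlaw n)
  have hGm : ∀ n, AEMeasurable (G n) P := fun n =>
    (measurable_centredRightmost θ (c n) n).comp_aemeasurable (hlaw n).aemeasurable
  have hstep : ∀ n, ∀ t < n, ∃ i, ζ n t = Z i := by
    intro n t ht
    obtain ⟨i, hi⟩ := exists_mem_timeStep (fun i => q i n) (t := t) (by rwa [hq_sum])
    exact ⟨i, stepLaw_of_mem Z _ hi⟩
  -- The law is exact for each `n`, so convergence of `G` in distribution is immediate.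
  have hGlaw : ∀ n, P.map (G n) = P'.map fun ω' => 1 / θ * (-Real.log (E' ω')) := by
    intro n
    have h1 : P.map (G n) = (P.map fun ω => (T n ω, fun v => E n v ω)).map
        (centredRightmost θ (c n) n) := by
      rw [AEMeasurable.map_map_of_aemeasurable
        (measurable_centredRightmost θ (c n) n).aemeasurable (hlaw n).aemeasurable]
      rfl
    rw [h1, (hlaw n).map_eq, map_centredRightmost hθ_pos, ← hE'.map_eq,
      AEMeasurable.map_map_of_aemeasurable (by fun_prop) hE'.aemeasurable]
    · rfl
    · refine ae_generation_nonempty fun t ht => ?_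
      obtain ⟨i, hi⟩ := hstep n t ht
      rw [hi]
      exact (hZ i).no_extinction
  have hlogE : AEMeasurable (fun ω' => 1 / θ * (-Real.log (E' ω'))) P' :=
    (hE'.aemeasurable.log).neg.const_mul _
  have hGlim : TendstoInDistribution G atTop (fun ω' => 1 / θ * (-Real.log (E' ω')))
      (fun _ => P) P' :=
    tendstoInDistribution_of_identDistrib 0
      (fun j => ⟨hGm 0, hGm j, (hGlaw 0).trans (hGlaw j).symm⟩) ⟨hGm 0, hlogE, hGlaw 0⟩
  have hNm : ∀ n, AEMeasurable (fun ω => normSum θ (c n) (T n ω) n) P := fun n =>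
    (measurable_normSum θ (c n) n).comp_aemeasurable (hT n).aemeasurable
  have hL1 : ∀ n, ∫⁻ ω, ‖normSum θ (c n) (T n ω) n - D ω‖ₑ ∂P
      ≤ ENNReal.ofReal (2 * ((1 + 3 * C) / (1 - s)) * s ^ q 0 n) := by
    intro n
    have hqn : q 0 n ≤ n := by
      conv_rhs => rw [← hq_sum n]
      exact Finset.single_le_sum (f := fun i => q i n) (fun _ _ => Nat.zero_le _)
        (Finset.mem_univ 0)
    refine lintegral_normSum_sub_martingaleLimit_le hp1.le hp2 hs0 hs1 hC hqn (hB 0)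
      (fun t ht => ?_) (fun t ht => stepLaw_of_mem Z _ (mem_timeStep_zero _ ht)) (hT n) hYtree ?_
    · obtain ⟨i, hi⟩ := hstep n t ht
      change MomentBounds θ p s C (ζ n t)
      rw [hi]
      exact hB i
    · rw [ae_all_iff]
      intro v
      by_cases hv : v.length < q 0 n
      · filter_upwards [hXY n v hv] with ω hω _
        rw [← hω]
        exact truncateTree_apply (hv.trans_le hqn)
      · exact ae_of_all _ fun ω hω => absurd hω hv
  -- Only the distance to `D` for each separate `n` is used, so the joint law of the processes plays
  -- no role.
  have hmeas : TendstoInMeasure P (fun n ω => normSum θ (c n) (T n ω) n) atTop D := by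
    refine tendstoInMeasure_of_tendsto_eLpNorm one_ne_zero
      (fun n => (hNm n).aestronglyMeasurable) hDm.aestronglyMeasurable ?_
    have hlim : Tendsto (fun n => ENNReal.ofReal (2 * ((1 + 3 * C) / (1 - s)) * s ^ q 0 n))
        atTop (𝓝 0) := by
      have := ((tendsto_pow_atTop_nhds_zero_of_lt_one hs0.le hs1).comp (hq 0)).const_mul
        (2 * ((1 + 3 * C) / (1 - s)))
      simpa using ENNReal.tendsto_ofReal this
    refine tendsto_of_tendsto_of_tendsto_of_le_of_le tendsto_const_nhds hlim
      (fun _ => zero_le) fun n => ?_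
    rw [eLpNorm_one_eq_lintegral_enorm]
    exact hL1 n
  have hlog := tendstoInMeasure_comp_of_continuousAt (φ := fun u => 1 / θ * Real.log u)
    (by fun_prop) hNm hmeas
    (by filter_upwards [hDpos] with ω hω using
      continuousAt_const.mul (Real.continuousAt_log hω.ne'))
  have hdiff : ∀ n ω, rightmost θ (fun v => X n v ω) (fun v => E n v ω) n
      - ∑ i, (q i n : ℝ) * nu (Z i) θ / θ - 1 / θ * Real.log (D ω) - G n ω
      = 1 / θ * Real.log (normSum θ (c n) (T n ω) n) - 1 / θ * Real.log (D ω) := by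
    intro n ω
    have hsum : (∑ t ∈ Finset.range n, c n t) / θ = ∑ i, (q i n : ℝ) * nu (Z i) θ / θ := by
      have := sum_nu_stepLaw Z (fun i => q i n) θ
      rw [hq_sum] at this
      rw [← Finset.sum_div, ← this]
    simp only [G, centredRightmost]
    rw [hsum, show rightmost θ (T n ω) (fun v => E n v ω) n = _ from
      rightmost_truncateTree θ _ _ n]
    ring
  -- Slutsky: replacing the logarithm of the normalised sum by `log D` changes `G` by a term tending
  -- to `0` in probability.
  refine tendstoInDistribution_of_tendstoInMeasure_sub _ _ hGlim ?_ fun n => ?_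
  · rw [tendstoInMeasure_iff_norm] at hlog ⊢
    intro ε hε
    refine (hlog ε hε).congr fun n => ?_
    simp only [Pi.sub_apply, Pi.zero_apply, sub_zero, hdiff]
  · have h2 : AEMeasurable (fun ω => G n ω + (1 / θ * Real.log (normSum θ (c n) (T n ω) n)
        - 1 / θ * Real.log (D ω))) P :=
      (hGm n).add (((hNm n).log.const_mul _).sub (hDm.log.const_mul _))
    refine h2.congr (ae_of_all _ fun ω => ?_)
    simp only
    rw [← hdiff n ω]
    ring
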